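/- Let $\lambda$ be a partition with conjugate $\lambda'$, let $L=\lambda_1$, and let $n\ge \ell(\lambda)$. A multiline queue $M\in\mathrm{MLQ}(\lambda,n)$ is a tuple $M=(B_1,\dots,B_L)$ of subsets $B_j\subseteq\{1,\dots,n\}$ with $|B_j|=\lambda'_j$; the elements of $B_j$ are the columns of the balls in row $j$, and rows are numbered from bottom to top. **Major index.** For $r=L,L-1,\dots,2$: label every unlabelled ball of row $r$ by $r$; then pair the balls of row $r$ one at a time, from the largest label to the smallest and from left to right among equal labels, each with the first not yet paired ball weakly to its right in row $r-1$, wrapping around from column $n$ to column $1$ if necessary; the ball of row $r-1$ receives the label of the ball that is paired to it. Then $\mathrm{maj}(M)=\sum_p(\ell(p)-r(p)+1)$, summed over the pairings $p$ that wrap, where $r(p)$ is the row from which $p$ originates and $\ell(p)$ is its label. **Charge.** For a permutation $\tau\in S_m$, $\mathrm{charge}(\tau)$ is the sum of $m-i$ over all $1\le i<m$ such that $i$ stands to the left of $i+1$ in the one-line notation of $\tau$. For a word $w$ with partition content, find its leftmost largest letter $k$, then, always moving to the right and looping back to the beginning when needed, the next $k-1$, then the next $k-2$, and so on down to $1$.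 These letters, in the order in which they stand in $w$, form a permutation; remove them and repeat until no letter is left. The charge of $w$ is the sum of the charges of these permutations. The charge of a semistandard Young tableau with partition content is the charge of its row reading word (French notation: rows increase weakly from left to right, columns increase strictly from bottom to top; the rows are read from top to bottom, each from left to right). **Collapsing.** For an arrangement of balls with rows numbered from bottom to top, the operator $e_i^\star$ acts as follows. Read the columns from left to right and, in each column, row $i+1$ before row $i$; write an opening parenthesis for each ball of row $i+1$ and a closing one for each ball of row $i$, and match the parentheses in the usual (non-cyclic) way. All balls of row $i+1$ that are unmatched drop to row $i$, in the same column. Let $N_0$ be the empty arrangement, and for $r=1,\dots,L$ let $N_r=e_1^\star e_2^\star\cdots e_{r-1}^\star(N_{r-1}\cup B_r)$, with $e_{r-1}^\star$ acting first, where $N_{r-1}\cup B_r$ is $N_{r-1}$ with $B_r$ placed in row $r$. The recording tableau $\rho_Q(M)$ is the tableau in which, for all $r$ and $j$, the number of entries $r$ in row $j$ (counted from the bottom) is the number of balls in row $j$ of $N_r$ minus the number of balls in row $j$ of $N_{r-1}$, each row being written in increasing order. **Theorem.** For every $M\in\mathrm{MLQ}(\lambda,n)$, the recording tableau $\rho_Q(M)$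 is a semistandard Young tableau with content $\lambda'$ (so that its charge is defined), and $$\mathrm{maj}(M)=\mathrm{charge}(\rho_Q(M)).$$ -/

import Mathlib

namespace MLQueue

/-- An arrangement of balls on rows `1, 2, 3, …` (numbered from bottom to top): `B r` is the set of
columns of the balls in row `r`. Columns are numbered `1, …, n` from left to right. -/
abbrev Rows := ℕ → Finset ℕ

/-- The multiline queues of shape `(lam, n)`: row `j` (for `1 ≤ j ≤ lam₁`) is a subset of
`{1, …, n}` with `lam'_j` elements; all other rows are empty, `lam'_j` being `0` for `j > lam₁`.
In `YoungDiagram`, rows and columns are numbered from `0`, so `lam'_j` is `lam.colLen (j - 1)`. -/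
def MLQ (lam : YoungDiagram) (n : ℕ) : Set Rows :=
  {M | M 0 = ∅ ∧ ∀ j, M (j + 1) ⊆ Finset.Icc 1 n ∧ (M (j + 1)).card = lam.colLen j}

/-- The first element of `S` weakly to the right of `c`, wrapping around to the smallest element
of `S` if there is none. -/
def cyclicNext (S : Finset ℕ) (c : ℕ) : Option ℕ :=
  if h : (S.filter (fun d => c ≤ d)).Nonempty then some ((S.filter (fun d => c ≤ d)).min' h)
  else if h : S.Nonempty then some (S.min' h)
  else none

/-! ### The Ferrari–Martin algorithm and the major index -/

/-- The balls of a list (given by their columns) are paired one after the other, each with the first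
ball of `S` weakly to its right (cyclically) that is not yet paired. The result lists
the pairings as (column of origin, column of target). -/
def pairBalls : Finset ℕ → List ℕ → List (ℕ × ℕ)
  | _, [] => []
  | S, c :: cs =>
    match cyclicNext S c with
    | some d => (c, d) :: pairBalls (S.erase d) cs
    | none => pairBalls S cs

/-- The balls of a row `A` with labels `lab` at most `L`, from the largest label to the smallest,
and from left to right among balls with the same label. -/
def pairingOrder (L : ℕ) (A : Finset ℕ) (lab : ℕ → ℕ) : List ℕ :=
  (List.range (L + 1)).reverse.flatMap fun l => (A.filter fun c => lab c = l).sort (· ≤ ·)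

/-- The pairings from row `r` to row `r - 1`, when the balls of row `r` carry the labels `lab`. -/
def pairsFrom (L : ℕ) (M : Rows) (r : ℕ) (lab : ℕ → ℕ) : List (ℕ × ℕ) :=
  pairBalls (M (r - 1)) (pairingOrder L (M r) lab)

/-- `fmLabel L M r c` is the label of the ball in row `r` and column `c` of a multiline queue `M`
with `L` rows. The balls in row `L` are labelled `L`. A ball in row `r < L` gets the label of the
ball in row `r + 1` that is paired to it, and the label `r` if there is no such ball. -/
def fmLabel (L : ℕ) (M : Rows) (r : ℕ) : ℕ → ℕ :=
  if r < L then fun d =>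
    match (pairsFrom L M (r + 1) (fmLabel L M (r + 1))).find? (fun p => p.2 = d) with
    | some p => fmLabel L M (r + 1) p.1
    | none => r
  else fun _ => L
termination_by L - r

/-- The pairings originating from row `r`, for `2 ≤ r ≤ L`. -/
def fmPairs (L : ℕ) (M : Rows) (r : ℕ) : List (ℕ × ℕ) :=
  pairsFrom L M r (fmLabel L M r)

/-- The major index: every wrapping pairing (its target is strictly to the left of its origin) that
originates from row `r` and has label `l ≥ r` contributes `l - r + 1`. -/
def maj (L : ℕ) (M : Rows) : ℕ :=
  ∑ r ∈ Finset.Icc 2 L,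
    ((fmPairs L M r).map fun p => if p.2 < p.1 then fmLabel L M r p.1 + 1 - r else 0).sum

/-! ### Charge -/

/-- The charge of a permutation `τ` of `{1, …, m}` in one-line notation: the sum of `m - i` over
`1 ≤ i < m` such that `i` stands to the left of `i + 1`. -/
def chargePerm (τ : List ℕ) : ℕ :=
  ∑ i ∈ Finset.Icc 1 (τ.length - 1),
    if τ.idxOf i < τ.idxOf (i + 1) then τ.length - i else 0

/-- The positions of the letter `a` in the word `w` (numbered from `0`). -/
def letterPositions (w : List ℕ) (a : ℕ) : Finset ℕ :=
  (Finset.range w.length).filter fun p => w[p]? = some a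

/-- Starting at position `q`, scan `w` cyclically from left to right for the letter `k`, from there
for `k - 1`, and so on down to `1`; returns the positions found. -/
def scanPositions (w : List ℕ) : ℕ → ℕ → List ℕ
  | _, 0 => []
  | q, k + 1 =>
    match cyclicNext (letterPositions w (k + 1)) q with
    | some p => p :: scanPositions w p k
    | none => []

/-- The positions of the first charge subword of `w`: the scan starts at the left end of `w` with
the largest letter. -/
def chargePositions (w : List ℕ) : List ℕ :=
  scanPositions w 0 (w.foldr max 0)

/-- The first charge subword of `w`, its letters in the order in which they stand in `w`. -/
def chargeSubword (w : List ℕ) : List ℕ :=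
  (w.zipIdx.filter fun x => x.2 ∈ chargePositions w).map Prod.fst

/-- What is left of `w` after the first charge subword is extracted. -/
def chargeRest (w : List ℕ) : List ℕ :=
  (w.zipIdx.filter fun x => x.2 ∉ chargePositions w).map Prod.fst

/-- The charge of a word with partition content: the sum of the charges of its successive
charge subwords, whose number is the number of letters `1` in the word. -/
def charge (w : List ℕ) : ℕ :=
  ∑ i ∈ Finset.range (w.count 1), chargePerm (chargeSubword (chargeRest^[i] w))

/-- The `i`-th row of a semistandard tableau, from left to right. Row `0` is the longest row; it is
the bottom row in French notation. -/
def tableauRow {μ : YoungDiagram} (T : SemistandardYoungTableau μ) (i : ℕ) : List ℕ :=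
  (List.range (μ.rowLen i)).map (T i)

/-- The row reading word: rows from top to bottom (French notation), each from left to right. -/
def rowReadingWord {μ : YoungDiagram} (T : SemistandardYoungTableau μ) : List ℕ :=
  (List.range (μ.colLen 0)).reverse.flatMap (tableauRow T)

/-- The charge of a semistandard tableau. -/
def tableauCharge {μ : YoungDiagram} (T : SemistandardYoungTableau μ) : ℕ :=
  charge (rowReadingWord T)

/-- The number of entries equal to `a` in a semistandard tableau. -/
def tableauContent {μ : YoungDiagram} (T : SemistandardYoungTableau μ) (a : ℕ) : ℕ :=
  (μ.cells.filter fun c => T c.1 c.2 = a).card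

/-! ### Collapsing -/

/-- The balls of an upper row `U` that are unmatched with the row `D` below it, under the (not
cylindrical) bracketing rule. The columns `1, …, n` are read from left to right and, within a column,
from top to bottom; a ball of `U` is an opening parenthesis and a ball of `D` a closing one. The
list is the stack of the opening parentheses that are still unmatched. -/
def unmatchedStack (n : ℕ) (U D : Finset ℕ) : List ℕ :=
  (List.range' 1 n).foldl
    (fun st c =>
      let st' := if c ∈ U then c :: st else st
      if c ∈ D then st'.tail else st') []

/-- The operator `e_i^⋆`: all balls in row `i + 1` that are unmatched with row `i` drop
to row `i`. -/
def dropStar (n i : ℕ) (B : Rows) : Rows :=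
  let X := (unmatchedStack n (B (i + 1)) (B i)).toFinset
  Function.update (Function.update B (i + 1) (B (i + 1) \ X)) i (B i ∪ X)

/-- The operator `e_1^⋆ e_2^⋆ ⋯ e_k^⋆`, with `e_k^⋆` acting first. -/
def dropRange (n : ℕ) : ℕ → Rows → Rows
  | 0, B => B
  | k + 1, B => dropRange n k (dropStar n (k + 1) B)

/-- `collapse n B r` is the result of collapsing the bottom `r` rows of `B`: row `r + 1` of `B` is
put on top of the collapse of the bottom `r` rows, and then `e_1^⋆ ⋯ e_r^⋆` is applied. -/
def collapse (n : ℕ) (B : Rows) : ℕ → Rows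
  | 0 => fun _ => ∅
  | r + 1 => dropRange n r (Function.update (collapse n B r) (r + 1) (B (r + 1)))

/-- The `j`-th row (`j ≥ 1`, from bottom to top) of the recording tableau of `B`, an arrangement with
`L` rows: for `r = 1, …, L` in this order, as many entries `r` as row `j` gains when the collapse of
the bottom `r - 1` rows is replaced by the collapse of the bottom `r` rows. -/
def recordingRow (n L : ℕ) (B : Rows) (j : ℕ) : List ℕ :=
  (List.range' 1 L).flatMap fun r =>
    List.replicate ((collapse n B r j).card - (collapse n B (r - 1) j).card) r

/-- `T` is the recording tableau of `B`, an arrangement with `L` rows and `n` columns: it has the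
prescribed rows, and its content is `(|B_1|, …, |B_L|)`. -/
def IsRecordingTableau (n L : ℕ) (B : Rows) {μ : YoungDiagram}
    (T : SemistandardYoungTableau μ) : Prop :=
  (∀ j, tableauRow T j = recordingRow n L B (j + 1)) ∧ ∀ a, tableauContent T a = (B a).card

end MLQueue

/-!
Everything depends on `M` only through its column reading word `arrWord`: the columns are read from
left to right, each from top to bottom, and a ball is recorded by the number of its row. The proof
compares both sides for this word and for the reading word of a tableau Knuth equivalent to it.

*Major index and charge are sums of energies.* A wrapping pairing from row `r` with label `l`
contributes `1` for each threshold between `r` and `l`, and the balls with label at least a given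
threshold `k` arise by pairing all of row `k` cyclically with row `k - 1`, their targets with row
`k - 2`, and so on. The set of targets and the number of wrappings do not depend on the order in
which the balls of a row are paired: both can be read off from a queue that is served
from left to right (`targets_insert`, `pairBalls_spec`). So the major index is the sum over `k` of
an `energy` of the word (`maj_eq_sum_rowEnergy`). Pairing the ball on the first charge subword first
in each row shows that the charge of a word with partition content is the same sum of energies
(`charge_eq_sum_energy`).

*Knuth invariance.* The energies do not change under elementary Knuth transformations
(`Plactic.energy_eq`). One round of cyclic matching sees only two consecutive letters, and once the
upper letter and the unmatched lower ones are removed, two words that differ by an elementary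
transformation become equal or still differ by one. Similarly, the operators `e_i^⋆` respect Knuth
equivalence (`Plactic.lower`), hence so does the collapse, and the row sizes recorded by the
recording tableau are letter multiplicities of collapsed words (`card_collapse`).

*Reduction to tableaux.* By row insertion, each word is Knuth equivalent to the reading word of a
semistandard tableau `T` (`exists_tableau`). The collapse of the reading word of `T` replaces each
entry `e ≤ r` by the number of its row (`collapseWord_tableauWord`), so that the recording tableau
is `T` itself (`recordingRow_eq_getD`). Its charge is the sum of the energies of its reading word,
which are those of `M`.
-/

namespace MLQueue

/-! ### Knuth equivalence -/

/-- Knuth equivalence of words, as the congruence for concatenation generated by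
`x z y ∼ z x y` for `x ≤ y < z` and `y x z ∼ y z x` for `x < y ≤ z`. -/
inductive Plactic : List ℕ → List ℕ → Prop
  | swapLeft {x y z : ℕ} (hxy : x ≤ y) (hyz : y < z) (v : List ℕ) :
      Plactic (x :: z :: y :: v) (z :: x :: y :: v)
  | swapRight {x y z : ℕ} (hxy : x < y) (hyz : y ≤ z) (v : List ℕ) :
      Plactic (y :: x :: z :: v) (y :: z :: x :: v)
  | cons (a : ℕ) {u v : List ℕ} : Plactic u v → Plactic (a :: u) (a :: v)
  | refl (u : List ℕ) : Plactic u u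
  | symm {u v : List ℕ} : Plactic u v → Plactic v u
  | trans {u v w : List ℕ} : Plactic u v → Plactic v w → Plactic u w

theorem Plactic.of_eq {u v : List ℕ} (h : u = v) : Plactic u v := h ▸ .refl u

theorem Plactic.append_left {u v : List ℕ} (h : Plactic u v) (s : List ℕ) :
    Plactic (s ++ u) (s ++ v) := by
  induction s with
  | nil => exact h
  | cons a s ih => exact ih.cons a

theorem Plactic.append_right {u v : List ℕ} (h : Plactic u v) (s : List ℕ) :
    Plactic (u ++ s) (v ++ s) := by
  induction h with
  | swapLeft hxy hyz v => exact .swapLeft hxy hyz _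
  | swapRight hxy hyz v => exact .swapRight hxy hyz _
  | cons a _ ih => exact ih.cons a
  | refl u => exact .refl _
  | symm _ ih => exact ih.symm
  | trans _ _ ih₁ ih₂ => exact ih₁.trans ih₂

theorem Plactic.perm {u v : List ℕ} (h : Plactic u v) : u.Perm v := by
  induction h with
  | swapLeft => exact .swap _ _ _
  | swapRight => exact (List.Perm.swap _ _ _).cons _
  | cons a _ ih => exact ih.cons a
  | refl u => exact .refl _
  | symm _ ih => exact ih.symm
  | trans _ _ ih₁ ih₂ => exact ih₁.trans ih₂

/-! ### The energies of a word -/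

/-- Reading a word from left to right, each letter `r + 1` joins a queue and each letter `r`
serves one member of the queue, if there is one. This is the length of the queue at
the end, when it is `c` at the beginning. -/
def queueLength (r : ℕ) : ℕ → List ℕ → ℕ
  | c, [] => c
  | c, a :: u =>
    if a = r + 1 then queueLength r (c + 1) u
    else if a = r then queueLength r (c - 1) u
    else queueLength r c u

/-- What is left of a word when all letters larger than `r` and all letters `r` that meet an empty
queue (of letters `r + 1`, of initial length `c`) are removed. -/
def keepServing (r : ℕ) : ℕ → List ℕ → List ℕ
  | _, [] => []
  | c, a :: u =>
    if a = r + 1 then keepServing r (c + 1) u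
    else if a = r then
      if 0 < c then a :: keepServing r (c - 1) u else keepServing r 0 u
    else if a < r then a :: keepServing r c u
    else keepServing r c u

/-- The energy of level `k`: all letters `k + 1` are matched cyclically with letters `k`, these
with letters `k - 1`, and so on; the energy is the total number of matchings that wrap around the
end of the word. -/
def energy : ℕ → List ℕ → ℕ
  | 0, _ => 0
  | k + 1, w =>
    queueLength (k + 1) 0 w + energy k (keepServing (k + 1) (queueLength (k + 1) 0 w) w)

theorem Plactic.queueLength_eq {u v : List ℕ} (h : Plactic u v) (r c : ℕ) :
    queueLength r c u = queueLength r c v := by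
  induction h generalizing c with
  | swapLeft hxy hyz v =>
    simp only [queueLength]
    grind
  | swapRight hxy hyz v =>
    simp only [queueLength]
    grind
  | cons a _ ih => simp only [queueLength, ih]
  | refl u => rfl
  | symm _ ih => exact (ih c).symm
  | trans _ _ ih₁ ih₂ => exact (ih₁ c).trans (ih₂ c)

theorem keepServing_succ_cons (r c : ℕ) (u : List ℕ) :
    keepServing r c ((r + 1) :: u) = keepServing r (c + 1) u := by
  simp [keepServing]

theorem keepServing_self_cons (r c : ℕ) (u : List ℕ) :
    keepServing r c (r :: u) = if 0 < c then r :: keepServing r (c - 1) u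
      else keepServing r 0 u := by
  simp [keepServing]

theorem keepServing_cons_of_lt {r a : ℕ} (h : a < r) (c : ℕ) (u : List ℕ) :
    keepServing r c (a :: u) = a :: keepServing r c u := by
  have h' : a ≠ r + 1 := by omega
  simp [keepServing, h, h.ne, h']

theorem keepServing_cons_of_gt {r a : ℕ} (h : r + 1 < a) (c : ℕ) (u : List ℕ) :
    keepServing r c (a :: u) = keepServing r c u := by
  have h₁ : a ≠ r := by omega
  have h₂ : ¬ a < r := by omega
  simp [keepServing, h.ne', h₁, h₂]

/-- After one round of matching, two words that differ by an elementary Knuth transformation are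
equal or still differ by one. -/
theorem Plactic.keepServing {u v : List ℕ} (h : Plactic u v) (r c : ℕ) :
    Plactic (keepServing r c u) (keepServing r c v) := by
  induction h generalizing c with
  | @swapLeft x y z hxy hyz v =>
    rcases (by omega : z < r ∨ z = r ∨ z = r + 1 ∨ r + 1 < z) with hz | rfl | rfl | hz
    · rw [keepServing_cons_of_lt (by omega), keepServing_cons_of_lt hz,
        keepServing_cons_of_lt (by omega), keepServing_cons_of_lt hz,
        keepServing_cons_of_lt (by omega), keepServing_cons_of_lt (by omega)]
      exact .swapLeft hxy hyz _
    · rw [keepServing_cons_of_lt (by omega), keepServing_self_cons, keepServing_self_cons]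
      simp only [keepServing_cons_of_lt hyz, keepServing_cons_of_lt (hxy.trans_lt hyz)]
      split_ifs
      · exact .swapLeft hxy hyz _
      · exact .refl _
    · apply Plactic.of_eq
      rcases (by omega : x = r ∧ y = r ∨ x < r) with ⟨rfl, rfl⟩ | hx
      · simp only [keepServing_succ_cons, keepServing_self_cons]
        rcases Nat.eq_zero_or_pos c with rfl | hc
        · simp
        · simp [hc, Nat.sub_add_cancel hc]
      · simp only [keepServing_cons_of_lt hx, keepServing_succ_cons]
    · apply Plactic.of_eq
      simp only [MLQueue.keepServing.eq_2 r _ x, keepServing_cons_of_gt hz]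
  | @swapRight x y z hxy hyz v =>
    rcases (by omega : z < r ∨ z = r ∨ z = r + 1 ∨ r + 1 < z) with hz | rfl | rfl | hz
    · simp only [keepServing_cons_of_lt hz, keepServing_cons_of_lt (hyz.trans_lt hz),
        keepServing_cons_of_lt ((hxy.trans_le hyz).trans hz)]
      exact .swapRight hxy hyz _
    · have hx : x < z := by omega
      rcases (by omega : y < z ∨ y = z) with hy | rfl
      · simp only [keepServing_cons_of_lt hx, keepServing_cons_of_lt hy, keepServing_self_cons]
        split_ifs
        · exact .swapRight hxy hyz _
        · exact .refl _
      · -- The second of two equal letters is kept only if the first one is.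
        simp only [keepServing_cons_of_lt hx, keepServing_self_cons]
        split_ifs
        · exact .swapRight hxy hyz _
        · exact .refl _
        · exact absurd ‹0 < 0› (lt_irrefl 0)
        · exact .refl _
    · apply Plactic.of_eq
      rcases (by omega : x = r ∧ y = r + 1 ∨ x < r) with ⟨rfl, rfl⟩ | hx
      · simp [MLQueue.keepServing]
      · have (c : ℕ) (u : List ℕ) : MLQueue.keepServing r c (x :: (r + 1) :: u) =
            MLQueue.keepServing r c ((r + 1) :: x :: u) := by
          simp only [keepServing_cons_of_lt hx, keepServing_succ_cons]
        simp only [MLQueue.keepServing.eq_2 r _ y, this]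
    · apply Plactic.of_eq
      simp only [MLQueue.keepServing.eq_2 r _ y, MLQueue.keepServing.eq_2 r _ x,
        keepServing_cons_of_gt hz]
  | cons a _ ih =>
    simp only [MLQueue.keepServing]
    split_ifs <;> first | exact ih _ | exact (ih _).cons _
  | refl u => exact .refl _
  | symm _ ih => exact (ih c).symm
  | trans _ _ ih₁ ih₂ => exact (ih₁ c).trans (ih₂ c)

theorem Plactic.energy_eq {u v : List ℕ} (h : Plactic u v) (k : ℕ) : energy k u = energy k v := by
  induction k generalizing u v with
  | zero => rfl
  | succ k ih =>
    simp only [energy, h.queueLength_eq]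
    rw [ih (h.keepServing _ _)]

/-! ### Collapsing words -/

/-- The number of letters `i` of a word that are not matched with a letter `i + 1` to their left,
when `d` further letters `i` follow the word. -/
def spare (i d : ℕ) : List ℕ → ℕ
  | [] => d
  | a :: u => if a = i then spare i d u + 1 else if a = i + 1 then spare i d u - 1 else spare i d u

/-- The operator `e_i^⋆` on words: each letter `i + 1` that is not matched with a letter `i` to its
right becomes a letter `i`. It is assumed that `d` further letters `i` follow the word. -/
def lower (i d : ℕ) : List ℕ → List ℕ
  | [] => []
  | a :: u => (if a = i + 1 ∧ spare i d u = 0 then i else a) :: lower i d u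

/-- The operator `e_1^⋆ ⋯ e_k^⋆` on words. -/
def lowerRange : ℕ → List ℕ → List ℕ
  | 0, w => w
  | k + 1, w => lowerRange k (lower (k + 1) 0 w)

/-- The collapse of the letters `1, …, r` of a word; larger letters are not affected. -/
def collapseWord : ℕ → List ℕ → List ℕ
  | 0, w => w
  | r + 1, w => lowerRange r (collapseWord r w)

theorem Plactic.spare_eq {u v : List ℕ} (h : Plactic u v) (i d : ℕ) :
    spare i d u = spare i d v := by
  induction h with
  | swapLeft hxy hyz v =>
    simp only [spare]
    grind
  | swapRight hxy hyz v =>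
    simp only [spare]
    grind
  | cons a _ ih => simp only [spare, ih]
  | refl u => rfl
  | symm _ ih => exact ih.symm
  | trans _ _ ih₁ ih₂ => exact ih₁.trans ih₂

/-- Lowering respects Knuth equivalence. It takes an elementary transformation to an elementary
transformation, possibly of the other kind. -/
theorem Plactic.lower {u v : List ℕ} (h : Plactic u v) (i d : ℕ) :
    Plactic (lower i d u) (lower i d v) := by
  induction h with
  | @swapLeft x y z hxy hyz v =>
    rcases (by omega : x = i ∨ x = i + 1 ∨ x ≠ i ∧ x ≠ i + 1) with hx | hx | hx <;>
    rcases (by omega : y = i ∨ y = i + 1 ∨ y ≠ i ∧ y ≠ i + 1) with hy | hy | hy <;>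
    rcases (by omega : z = i ∨ z = i + 1 ∨ z ≠ i ∧ z ≠ i + 1) with hz | hz | hz <;>
    first
      | omega
      | (simp only [MLQueue.lower, spare, hx, hy, hz, if_true, if_false, true_and, false_and,
            Nat.succ_ne_self, Nat.add_eq_zero_iff, one_ne_zero, and_false,
            (Nat.succ_ne_self i).symm]
         (try split_ifs) <;> first
          | omega
          | (apply Plactic.swapLeft <;> omega))
  | @swapRight x y z hxy hyz v =>
    rcases (by omega : x = i ∨ x = i + 1 ∨ x ≠ i ∧ x ≠ i + 1) with hx | hx | hx <;>
    rcases (by omega : y = i ∨ y = i + 1 ∨ y ≠ i ∧ y ≠ i + 1) with hy | hy | hy <;>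
    rcases (by omega : z = i ∨ z = i + 1 ∨ z ≠ i ∧ z ≠ i + 1) with hz | hz | hz <;>
    first
      | omega
      | (simp only [MLQueue.lower, spare, hx, hy, hz, if_true, if_false, true_and, false_and,
            Nat.succ_ne_self, Nat.add_eq_zero_iff, one_ne_zero, and_false,
            (Nat.succ_ne_self i).symm]
         -- If `x = i` and `y = z = i + 1`, then `y x z` and `y z x` may turn into
         -- `y x x` and `x y x`.
         (try split_ifs) <;> first
          | omega
          | (apply Plactic.swapRight <;> omega)
          | exact (Plactic.swapLeft le_rfl (by omega) _).symm)
  | cons a h ih =>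
    simp only [MLQueue.lower, h.spare_eq]
    exact ih.cons _
  | refl u => exact .refl _
  | symm _ ih => exact ih.symm
  | trans _ _ ih₁ ih₂ => exact ih₁.trans ih₂

theorem Plactic.lowerRange {u v : List ℕ} (h : Plactic u v) (k : ℕ) :
    Plactic (lowerRange k u) (lowerRange k v) := by
  induction k generalizing u v with
  | zero => exact h
  | succ k ih => exact ih (h.lower _ _)

theorem Plactic.collapseWord {u v : List ℕ} (h : Plactic u v) (r : ℕ) :
    Plactic (collapseWord r u) (collapseWord r v) := by
  induction r with
  | zero => exact h
  | succ r ih => exact ih.lowerRange r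

/-! ### Row insertion -/

/-- Row insertion of `x`: it takes the place of the leftmost entry that is larger, and is
appended if there is none. -/
def rowInsert (x : ℕ) : List ℕ → List ℕ
  | [] => [x]
  | a :: R => if x < a then x :: R else a :: rowInsert x R

/-- The entry that leaves the row `R` when `x` is inserted. -/
def bumped (x : ℕ) (R : List ℕ) : Option ℕ := R.find? fun a => x < a

/-- The row `U` may stand above the row `R` in a tableau: it is not longer, and its
entries are larger than those below them. -/
def Above : List ℕ → List ℕ → Prop
  | _, [] => True
  | [], _ :: _ => False
  | a :: R, b :: U => a < b ∧ Above R U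

/-- The list of the rows, from bottom to top, of a semistandard tableau in French notation. -/
def IsTableau : List (List ℕ) → Prop
  | [] => True
  | R :: t => R ≠ [] ∧ R.Pairwise (· ≤ ·) ∧ Above R (t.headD []) ∧ IsTableau t

/-- The reading word of a list of rows, the last row being read first. -/
def tableauWord : List (List ℕ) → List ℕ
  | [] => []
  | R :: t => tableauWord t ++ R

/-- Schensted insertion of `x` into a tableau. -/
def tableauInsert (x : ℕ) : List (List ℕ) → List (List ℕ)
  | [] => [[x]]
  | R :: t =>
    match bumped x R with
    | none => rowInsert x R :: t
    | some y => rowInsert x R :: tableauInsert y t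

theorem bumped_cons_of_lt {x a : ℕ} (h : x < a) (R : List ℕ) : bumped x (a :: R) = some a := by
  simp [bumped, h]

theorem bumped_cons_of_le {x a : ℕ} (h : a ≤ x) (R : List ℕ) :
    bumped x (a :: R) = bumped x R := by
  simp [bumped, h]

theorem lt_of_bumped {x y : ℕ} {R : List ℕ} (h : bumped x R = some y) : x < y := by
  simpa using List.find?_some h

theorem rowInsert_ne_nil (x : ℕ) (R : List ℕ) : rowInsert x R ≠ [] := by
  cases R with
  | nil => simp [rowInsert]
  | cons a R => simp only [rowInsert]; split_ifs <;> simp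

theorem mem_rowInsert {x e : ℕ} {R : List ℕ} (h : e ∈ rowInsert x R) : e = x ∨ e ∈ R := by
  induction R with
  | nil => simpa [rowInsert] using h
  | cons a R ih =>
    simp only [rowInsert] at h
    split_ifs at h
    · grind
    · grind

theorem rowInsert_sorted {x : ℕ} {R : List ℕ} (h : R.Pairwise (· ≤ ·)) :
    (rowInsert x R).Pairwise (· ≤ ·) := by
  induction R with
  | nil => simp [rowInsert]
  | cons a R ih =>
    rw [List.pairwise_cons] at h
    simp only [rowInsert]
    split_ifs with hx
    · exact List.pairwise_cons.2 ⟨fun e he => hx.le.trans (h.1 e he), h.2⟩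
    · refine List.pairwise_cons.2 ⟨fun e he => ?_, ih h.2⟩
      rcases mem_rowInsert he with rfl | he
      · omega
      · exact h.1 e he

theorem rowInsert_eq_append {x : ℕ} {R : List ℕ} (h : bumped x R = none) :
    rowInsert x R = R ++ [x] := by
  induction R with
  | nil => rfl
  | cons a R ih =>
    rcases lt_or_ge x a with hx | hx
    · simp [bumped_cons_of_lt hx] at h
    · rw [bumped_cons_of_le hx] at h
      simp [rowInsert, hx.not_gt, ih h]

/-- A letter moves to the left past larger letters in weakly increasing order, the first of which
stays in front. -/
theorem plactic_move_left {x a : ℕ} {R : List ℕ} (hx : x < a) (h : (a :: R).Pairwise (· ≤ ·)) :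
    Plactic (a :: (R ++ [x])) (a :: x :: R) := by
  induction R generalizing a with
  | nil => exact .refl _
  | cons c R ih =>
    obtain ⟨h₁, h₂⟩ := List.pairwise_cons.1 h
    have hac : a ≤ c := h₁ c (by simp)
    exact ((ih (hx.trans_le hac) h₂).cons a).trans (Plactic.swapRight hx hac R).symm

theorem plactic_rowInsert {x y : ℕ} {R : List ℕ} (hR : R.Pairwise (· ≤ ·))
    (h : bumped x R = some y) : Plactic (R ++ [x]) (y :: rowInsert x R) := by
  induction R with
  | nil => simp [bumped] at h
  | cons a R ih =>
    rcases lt_or_ge x a with hx | hx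
    · rw [bumped_cons_of_lt hx, Option.some_inj] at h
      subst h
      simpa [rowInsert, hx] using plactic_move_left hx hR
    · rw [bumped_cons_of_le hx] at h
      have hxy := lt_of_bumped h
      obtain ⟨hR₁, hR₂⟩ := List.pairwise_cons.1 hR
      have hsw : Plactic (a :: y :: rowInsert x R) (y :: a :: rowInsert x R) := by
        cases R with
        | nil => simp [bumped] at h
        | cons b R =>
          simp only [rowInsert]
          split_ifs with hb
          · exact .swapLeft hx hxy _
          · exact .swapLeft (hR₁ b (by simp)) (by omega) _
      simpa [rowInsert, hx.not_gt] using ((ih hR₂ h).cons a).trans hsw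

theorem above_nil (R : List ℕ) : Above R [] := by
  cases R <;> trivial

theorem Above.append {R U : List ℕ} (h : Above R U) (s : List ℕ) : Above (R ++ s) U := by
  induction R generalizing U with
  | nil =>
    cases U with
    | nil => exact above_nil _
    | cons b U => exact h.elim
  | cons a R ih =>
    cases U with
    | nil => exact above_nil _
    | cons b U => exact ⟨h.1, ih h.2⟩

theorem Above.rowInsert_left {x y : ℕ} {R U : List ℕ} (hb : bumped x R = some y)
    (h : Above R U) : Above (rowInsert x R) U := by
  induction R generalizing U with
  | nil => simp [bumped] at hb
  | cons a R ih =>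
    cases U with
    | nil => exact above_nil _
    | cons b U =>
      rcases lt_or_ge x a with hx | hx
      · simp only [rowInsert, hx, if_true]
        exact ⟨hx.trans h.1, h.2⟩
      · rw [bumped_cons_of_le hx] at hb
        simp only [rowInsert, hx.not_gt, if_false]
        exact ⟨h.1, ih hb h.2⟩

/-- The bumped entry, inserted into the row above, lands weakly to the left of its old place. -/
theorem Above.rowInsert_rowInsert {x y : ℕ} {R U : List ℕ} (hb : bumped x R = some y)
    (h : Above R U) : Above (rowInsert x R) (rowInsert y U) := by
  induction R generalizing U with
  | nil => simp [bumped] at hb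
  | cons a R ih =>
    rcases lt_or_ge x a with hx | hx
    · rw [bumped_cons_of_lt hx, Option.some_inj] at hb
      subst hb
      simp only [rowInsert, hx, if_true]
      cases U with
      | nil => exact ⟨hx, above_nil _⟩
      | cons b U =>
        simp only [rowInsert, h.1, if_true]
        exact ⟨hx, h.2⟩
    · rw [bumped_cons_of_le hx] at hb
      have hxy := lt_of_bumped hb
      simp only [rowInsert, hx.not_gt, if_false]
      cases U with
      | nil => exact ⟨hx.trans_lt hxy, above_nil _⟩
      | cons b U =>
        simp only [rowInsert]
        split_ifs
        · exact ⟨hx.trans_lt hxy, h.2.rowInsert_left hb⟩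
        · exact ⟨h.1, ih hb h.2⟩

theorem headD_tableauInsert (y : ℕ) (t : List (List ℕ)) :
    (tableauInsert y t).headD [] = rowInsert y (t.headD []) := by
  cases t with
  | nil => rfl
  | cons R t =>
    simp only [tableauInsert]
    split <;> rfl

theorem IsTableau.tableauInsert {t : List (List ℕ)} (h : IsTableau t) (x : ℕ) :
    IsTableau (tableauInsert x t) := by
  induction t generalizing x with
  | nil => simp [MLQueue.tableauInsert, IsTableau, Above]
  | cons R t ih =>
    obtain ⟨-, hs, ha, ht⟩ := h
    simp only [MLQueue.tableauInsert]
    split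
    next hb =>
      refine ⟨rowInsert_ne_nil _ _, rowInsert_sorted hs, ?_, ht⟩
      rw [rowInsert_eq_append hb]
      exact ha.append _
    next y hb =>
      refine ⟨rowInsert_ne_nil _ _, rowInsert_sorted hs, ?_, ih ht y⟩
      rw [headD_tableauInsert]
      exact ha.rowInsert_rowInsert hb

theorem plactic_tableauInsert {t : List (List ℕ)} (h : IsTableau t) (x : ℕ) :
    Plactic (tableauWord t ++ [x]) (tableauWord (tableauInsert x t)) := by
  induction t generalizing x with
  | nil => exact .refl _
  | cons R t ih =>
    simp only [tableauInsert]
    split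
    next hb =>
      apply Plactic.of_eq
      simp [tableauWord, rowInsert_eq_append hb]
    next y hb =>
      have h₁ := (plactic_rowInsert h.2.1 hb).append_left (tableauWord t)
      have h₂ := (ih h.2.2.2 y).append_right (rowInsert x R)
      simp only [tableauWord, List.append_assoc, List.singleton_append] at h₁ h₂ ⊢
      exact h₁.trans h₂

/-- Every word is Knuth equivalent to the reading word of a tableau. -/
theorem exists_tableau (w : List ℕ) : ∃ t, IsTableau t ∧ Plactic w (tableauWord t) := by
  induction w using List.reverseRecOn with
  | nil => exact ⟨[], trivial, .refl _⟩
  | append_singleton w x ih =>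
    obtain ⟨t, ht, hw⟩ := ih
    exact ⟨tableauInsert x t, ht.tableauInsert x,
      (hw.append_right [x]).trans (plactic_tableauInsert ht x)⟩

/-! ### The collapse of the reading word of a tableau -/

theorem Above.succ_le {j : ℕ} {R U : List ℕ} (h : Above R U) (hj : ∀ e ∈ R, j ≤ e) :
    ∀ e ∈ U, j + 1 ≤ e := by
  induction R generalizing U with
  | nil =>
    cases U with
    | nil => simp
    | cons b U => exact h.elim
  | cons a R ih =>
    cases U with
    | nil => simp
    | cons b U =>
      intro e he
      rcases List.mem_cons.1 he with rfl | he
      · exact (hj a (by simp)).trans_lt h.1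
      · exact ih h.2 (fun e he => hj e (by simp [he])) e he

theorem Above.countP_le {R U : List ℕ} (h : Above R U) (r : ℕ) :
    U.countP (· ≤ r) ≤ R.countP (· < r) := by
  induction R generalizing U with
  | nil =>
    cases U with
    | nil => simp
    | cons b U => exact h.elim
  | cons a R ih =>
    cases U with
    | nil => simp
    | cons b U =>
      have h₁ := h.1
      have h₂ := ih h.2
      simp only [List.countP_cons, decide_eq_true_eq]
      split_ifs <;> omega

/-- The letter into which an entry `e` of row `j` has turned, in the course of the collapse of the
letters `1, …, r`, once the operators `e_{r-1}^⋆, …, e_k^⋆` have been applied. -/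
def levelEntry (r k j e : ℕ) : ℕ := if e < r then j else if e = r then max j k else e

/-- The reading word of the rows `t`, numbered from `j` on, with `levelEntry` applied. -/
def levelWord (r k : ℕ) : ℕ → List (List ℕ) → List ℕ
  | _, [] => []
  | j, R :: t => levelWord r k (j + 1) t ++ R.map (levelEntry r k j)

theorem spare_append (i d : ℕ) (u v : List ℕ) :
    spare i d (u ++ v) = spare i (spare i d v) u := by
  induction u with
  | nil => rfl
  | cons a u ih => simp only [List.cons_append, spare, ih]

theorem lower_append (i d : ℕ) (u v : List ℕ) :
    lower i d (u ++ v) = lower i (spare i d v) u ++ lower i d v := by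
  induction u with
  | nil => rfl
  | cons a u ih => simp only [List.cons_append, lower, ih, spare_append]

/-- In the rows below row `k`, there is no letter `k`. -/
theorem lower_row_of_lt {r k j : ℕ} (hj : j < k) (hk : k < r) (R : List ℕ) :
    spare k 0 (R.map (levelEntry r (k + 1) j)) = 0 ∧
      lower k 0 (R.map (levelEntry r (k + 1) j)) = R.map (levelEntry r k j) := by
  induction R with
  | nil => exact ⟨rfl, rfl⟩
  | cons e R ih =>
    obtain ⟨h₁, h₂⟩ := ih
    simp only [List.map_cons, spare, lower, h₁, h₂, levelEntry]
    refine ⟨?_, ?_⟩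
    · split_ifs <;> omega
    · congr 1
      rw [max_eq_right (by omega : j ≤ k + 1), max_eq_right hj.le]
      rcases lt_trichotomy e r with he | rfl | he
      · simp only [he, if_true]
        split_ifs <;> omega
      · simp
      · simp only [he.not_gt, he.ne', if_false]
        split_ifs <;> omega

/-- In row `k`, the new letters stand to the right of the old ones, which are letters `k`. -/
theorem lower_row_self {r k : ℕ} (hk : k < r) {R : List ℕ} (hR : R.Pairwise (· ≤ ·)) :
    spare k 0 (R.map (levelEntry r (k + 1) k)) = R.countP (· < r) ∧
      lower k 0 (R.map (levelEntry r (k + 1) k)) = R.map (levelEntry r k k) := by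
  induction R with
  | nil => exact ⟨rfl, rfl⟩
  | cons e R ih =>
    rw [List.pairwise_cons] at hR
    obtain ⟨h₁, h₂⟩ := ih hR.2
    have h₃ : r ≤ e → R.countP (· < r) = 0 := fun he => by
      rw [List.countP_eq_zero]
      intro f hf
      have := hR.1 f hf
      simp only [decide_eq_true_eq]
      omega
    simp only [List.map_cons, spare, lower, h₁, h₂, levelEntry, List.countP_cons,
      decide_eq_true_eq]
    refine ⟨?_, ?_⟩
    · split_ifs <;> omega
    · congr 1
      split_ifs <;> omega

/-- The letters of row `k + 1` are matched, if there are enough letters `k` below them. -/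
theorem lower_row_succ {r k d : ℕ} (hk : k < r) {R : List ℕ} (hd : R.countP (· ≤ r) ≤ d) :
    d ≤ spare k d (R.map (levelEntry r (k + 1) (k + 1))) + R.countP (· ≤ r) ∧
      lower k d (R.map (levelEntry r (k + 1) (k + 1))) = R.map (levelEntry r k (k + 1)) := by
  induction R with
  | nil => exact ⟨le_rfl, rfl⟩
  | cons e R ih =>
    simp only [List.countP_cons, decide_eq_true_eq] at hd
    obtain ⟨h₁, h₂⟩ := ih (by omega)
    simp only [List.map_cons, spare, lower, h₂, levelEntry, List.countP_cons,
      decide_eq_true_eq]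
    refine ⟨?_, ?_⟩
    · split_ifs <;> omega
    · congr 1
      split_ifs at hd ⊢ <;> omega

theorem lower_row_of_gt {r k j : ℕ} (hj : k + 1 < j) (hk : k < r) (d : ℕ) (R : List ℕ) :
    lower k d (R.map (levelEntry r (k + 1) j)) = R.map (levelEntry r k j) := by
  induction R with
  | nil => rfl
  | cons e R ih =>
    simp only [List.map_cons, lower, ih, levelEntry]
    congr 1
    split_ifs <;> omega

theorem lower_levelWord_of_gt {r k j : ℕ} (hj : k + 1 < j) (hk : k < r) (d : ℕ)
    (t : List (List ℕ)) : lower k d (levelWord r (k + 1) j t) = levelWord r k j t := by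
  induction t generalizing j d with
  | nil => rfl
  | cons R t ih =>
    simp only [levelWord]
    rw [lower_append, lower_row_of_gt hj hk, ih (by omega)]

theorem lower_levelWord_succ {r k d : ℕ} (hk : k < r) {t : List (List ℕ)}
    (hd : (t.headD []).countP (· ≤ r) ≤ d) :
    lower k d (levelWord r (k + 1) (k + 1) t) = levelWord r k (k + 1) t := by
  cases t with
  | nil => rfl
  | cons R t =>
    simp only [levelWord]
    rw [lower_append, (lower_row_succ hk (R := R) hd).2, lower_levelWord_of_gt (by omega) hk]

theorem lower_levelWord {r k j : ℕ} (hj : j ≤ k) (hk : k < r) {t : List (List ℕ)}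
    (ht : IsTableau t) : lower k 0 (levelWord r (k + 1) j t) = levelWord r k j t := by
  induction t generalizing j with
  | nil => rfl
  | cons R t ih =>
    simp only [levelWord]
    rw [lower_append]
    obtain ⟨-, hs, ha, ht⟩ := ht
    rcases hj.lt_or_eq with hj | rfl
    · obtain ⟨h₁, h₂⟩ := lower_row_of_lt hj hk R
      rw [h₁, h₂, ih (by omega) ht]
    · obtain ⟨h₁, h₂⟩ := lower_row_self hk hs
      rw [h₁, h₂, lower_levelWord_succ hk (ha.countP_le r)]

theorem lowerRange_levelWord {r k : ℕ} (hk : k < r) {t : List (List ℕ)} (ht : IsTableau t) :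
    lowerRange k (levelWord r (k + 1) 1 t) = levelWord r 1 1 t := by
  induction k with
  | zero => rfl
  | succ k ih =>
    rw [lowerRange, lower_levelWord (by omega) hk ht]
    exact ih (by omega)

theorem levelWord_zero {k j : ℕ} {t : List (List ℕ)} (ht : IsTableau t)
    (hj : ∀ e ∈ t.headD [], j ≤ e) (hj0 : 0 < j) : levelWord 0 k j t = tableauWord t := by
  induction t generalizing j with
  | nil => rfl
  | cons R t ih =>
    simp only [List.headD_cons] at hj
    simp only [levelWord, tableauWord]
    rw [ih ht.2.2.2 (ht.2.2.1.succ_le hj) (by omega)]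
    congr 1
    conv_rhs => rw [← List.map_id R]
    refine List.map_congr_left fun e he => ?_
    have := hj e he
    simp only [levelEntry, id]
    split_ifs <;> omega

/-- The letters `r + 1` have not moved when the collapse of the letters `1, …, r` is complete. -/
theorem levelWord_succ {r j : ℕ} {t : List (List ℕ)} (ht : IsTableau t)
    (hj : ∀ e ∈ t.headD [], j ≤ e) (hj0 : 0 < j) :
    levelWord r 1 j t = levelWord (r + 1) (r + 1) j t := by
  induction t generalizing j with
  | nil => rfl
  | cons R t ih =>
    simp only [List.headD_cons] at hj
    simp only [levelWord]
    rw [ih ht.2.2.2 (ht.2.2.1.succ_le hj) (by omega)]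
    congr 1
    refine List.map_congr_left fun e he => ?_
    have := hj e he
    simp only [levelEntry]
    split_ifs <;> omega

/-- The collapse turns each entry `e ≤ r` of row `j` of a tableau into the letter `j`. -/
theorem collapseWord_tableauWord (r : ℕ) {t : List (List ℕ)} (ht : IsTableau t)
    (h1 : ∀ e ∈ t.headD [], 1 ≤ e) : collapseWord r (tableauWord t) = levelWord r 1 1 t := by
  induction r with
  | zero => exact (levelWord_zero ht h1 one_pos).symm
  | succ r ih =>
    rw [collapseWord, ih, levelWord_succ ht h1 one_pos, lowerRange_levelWord (by omega) ht]

theorem count_levelWord_of_lt {r j m : ℕ} (hm : m ≤ r) (hj : m < j) (t : List (List ℕ)) :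
    (levelWord r 1 j t).count m = 0 := by
  induction t generalizing j with
  | nil => rfl
  | cons R t ih =>
    simp only [levelWord, List.count_append, ih (hj.trans j.lt_succ_self), zero_add]
    rw [List.count_eq_zero, List.mem_map]
    rintro ⟨e, -, he⟩
    simp only [levelEntry] at he
    split_ifs at he <;> omega

theorem count_levelWord {r j i : ℕ} (hj : 0 < j) (hi : j + i ≤ r) (t : List (List ℕ)) :
    (levelWord r 1 j t).count (j + i) = (t.getD i []).countP (· ≤ r) := by
  induction t generalizing j i with
  | nil => simp [levelWord]
  | cons R t ih =>
    simp only [levelWord, List.count_append]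
    cases i with
    | zero =>
      rw [count_levelWord_of_lt hi (by omega), zero_add, List.count, List.countP_map]
      simp only [List.getD_cons_zero]
      refine List.countP_congr fun e _ => ?_
      simp only [Function.comp_apply, levelEntry, beq_iff_eq, decide_eq_true_eq]
      split_ifs <;> omega
    | succ i =>
      have h0 : (R.map (levelEntry r 1 j)).count (j + (i + 1)) = 0 := by
        rw [List.count_eq_zero, List.mem_map]
        rintro ⟨e, -, he⟩
        simp only [levelEntry] at he
        split_ifs at he <;> omega
      rw [h0, add_zero, List.getD_cons_succ, ← ih (j := j + 1) (i := i) (by omega) (by omega)]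
      congr 1
      omega

/-! ### Cyclic pairing of two rows as a queue -/

/-- Reading the columns from left to right, each ball of `A` joins a queue and then each ball of
`S` serves one member of the queue, if there is one. This is the length of the
queue at the end, when it is `c` at the beginning. -/
def queueEnd (A S : Finset ℕ) : ℕ → List ℕ → ℕ
  | c, [] => c
  | c, x :: u => queueEnd A S (c + (if x ∈ A then 1 else 0) - (if x ∈ S then 1 else 0)) u

/-- The columns of the balls of `S` that serve a member of the queue. -/
def serving (A S : Finset ℕ) : ℕ → List ℕ → Finset ℕ
  | _, [] => ∅
  | c, x :: u =>
    (if x ∈ S ∧ 0 < c + (if x ∈ A then 1 else 0) then {x} else ∅) ∪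
      serving A S (c + (if x ∈ A then 1 else 0) - (if x ∈ S then 1 else 0)) u

/-- The number of pairings that wrap around when `A` is paired with `S`: the balls that are still
in the queue at the right end. -/
def wraps (cs : List ℕ) (A S : Finset ℕ) : ℕ := queueEnd A S 0 cs

/-- The balls of `S` to which the balls of `A` are paired cyclically. The queue starts with the
balls that wrap around. -/
def targets (cs : List ℕ) (A S : Finset ℕ) : Finset ℕ := serving A S (wraps cs A S) cs

section Queue

variable {A A' S : Finset ℕ}

theorem queueEnd_append (c : ℕ) (u v : List ℕ) :
    queueEnd A S c (u ++ v) = queueEnd A S (queueEnd A S c u) v := by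
  induction u generalizing c with
  | nil => rfl
  | cons x u ih => simp only [List.cons_append, queueEnd, ih]

theorem serving_append (c : ℕ) (u v : List ℕ) :
    serving A S c (u ++ v) = serving A S c u ∪ serving A S (queueEnd A S c u) v := by
  induction u generalizing c with
  | nil => simp [serving, queueEnd]
  | cons x u ih => simp only [List.cons_append, serving, queueEnd, ih, Finset.union_assoc]

theorem queueEnd_congr {cs : List ℕ} (h : ∀ x ∈ cs, x ∈ A ↔ x ∈ A') (c : ℕ) :
    queueEnd A S c cs = queueEnd A' S c cs := by
  induction cs generalizing c with
  | nil => rfl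
  | cons x u ih =>
    simp only [List.mem_cons, forall_eq_or_imp] at h
    simp only [queueEnd, h.1, ih h.2]

theorem serving_congr {cs : List ℕ} (h : ∀ x ∈ cs, x ∈ A ↔ x ∈ A') (c : ℕ) :
    serving A S c cs = serving A' S c cs := by
  induction cs generalizing c with
  | nil => rfl
  | cons x u ih =>
    simp only [List.mem_cons, forall_eq_or_imp] at h
    simp only [serving, h.1, ih h.2]

theorem mem_of_mem_serving {c x : ℕ} {cs : List ℕ} (h : x ∈ serving A S c cs) :
    x ∈ S ∧ x ∈ cs := by
  induction cs generalizing c with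
  | nil => simp [serving] at h
  | cons y u ih =>
    simp only [serving, Finset.mem_union] at h
    rcases h with h | h
    · by_cases hy : y ∈ S ∧ 0 < c + (if y ∈ A then 1 else 0)
      · rw [if_pos hy, Finset.mem_singleton] at h
        subst h
        exact ⟨hy.1, by simp⟩
      · rw [if_neg hy] at h
        simp at h
    · exact ⟨(ih h).1, List.mem_cons_of_mem _ (ih h).2⟩

theorem mem_serving_cons {c x y : ℕ} {u : List ℕ} (hy : y ≠ x) :
    y ∈ serving A S c (x :: u) ↔
      y ∈ serving A S (c + (if x ∈ A then 1 else 0) - (if x ∈ S then 1 else 0)) u := by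
  simp only [serving, Finset.mem_union]
  split_ifs <;> simp [hy]

theorem self_mem_serving_cons {c x : ℕ} {u : List ℕ} (hx : x ∉ u) :
    x ∈ serving A S c (x :: u) ↔ x ∈ S ∧ 0 < c + (if x ∈ A then 1 else 0) := by
  simp only [serving, Finset.mem_union]
  constructor
  · rintro (h | h)
    · by_contra h'
      rw [if_neg h'] at h
      simp at h
    · exact absurd (mem_of_mem_serving h).2 hx
  · intro h
    left
    simp [h]

theorem queueEnd_mono {c c' : ℕ} (h : c ≤ c') (cs : List ℕ) :
    queueEnd A S c cs ≤ queueEnd A S c' cs := by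
  induction cs generalizing c c' with
  | nil => exact h
  | cons x u ih => exact ih (by omega)

/-- The members of the queue are served or are still there at the end. -/
theorem card_serving {cs : List ℕ} (hcs : cs.Nodup) (c : ℕ) :
    (serving A S c cs).card + queueEnd A S c cs = c + cs.countP (· ∈ A) := by
  induction cs generalizing c with
  | nil => simp [serving, queueEnd]
  | cons x u ih =>
    rw [List.nodup_cons] at hcs
    have hd : Disjoint (if x ∈ S ∧ 0 < c + (if x ∈ A then 1 else 0) then {x} else ∅)
        (serving A S (c + (if x ∈ A then 1 else 0) - (if x ∈ S then 1 else 0)) u) := by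
      split_ifs <;> simp only [Finset.disjoint_singleton_left, Finset.disjoint_empty_left] <;>
        exact fun h => hcs.1 (mem_of_mem_serving h).2
    have h := ih hcs.2 (c + (if x ∈ A then 1 else 0) - (if x ∈ S then 1 else 0))
    simp only [serving, queueEnd, Finset.card_union_of_disjoint hd, List.countP_cons,
      decide_eq_true_eq]
    split_ifs at h ⊢ <;> simp only [Finset.card_singleton, Finset.card_empty] <;> grind

/-- A longer queue makes no difference at the end, if some ball of `S` is not needed. -/
theorem queueEnd_eq_of_free {c c' d : ℕ} (hc : c' ≤ c) {cs : List ℕ} (hcs : cs.Nodup)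
    (hd : d ∈ cs) (hS : d ∈ S) (hf : d ∉ serving A S c cs) :
    queueEnd A S c cs = queueEnd A S c' cs := by
  induction cs generalizing c c' with
  | nil => simp at hd
  | cons x u ih =>
    rw [List.nodup_cons] at hcs
    simp only [queueEnd]
    rcases List.mem_cons.1 hd with rfl | hd
    · rw [self_mem_serving_cons hcs.1] at hf
      have : c = 0 := by
        by_contra h
        exact hf ⟨hS, by omega⟩
      have : c' = c := by omega
      rw [this]
    · have hdx : d ≠ x := fun h => hcs.1 (h ▸ hd)
      rw [mem_serving_cons hdx] at hf
      exact ih (by omega) hcs.2 hd hf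

/-- If every ball of `S` serves, then one more member in the queue stays in it. -/
theorem serving_succ_of_full {c : ℕ} {cs : List ℕ} (hcs : cs.Nodup)
    (h : ∀ x ∈ cs, x ∈ S → x ∈ serving A S c cs) :
    queueEnd A S (c + 1) cs = queueEnd A S c cs + 1 ∧
      serving A S (c + 1) cs = serving A S c cs := by
  induction cs generalizing c with
  | nil => exact ⟨rfl, rfl⟩
  | cons x u ih =>
    rw [List.nodup_cons] at hcs
    have hu : ∀ y ∈ u, y ∈ S →
        y ∈ serving A S (c + (if x ∈ A then 1 else 0) - (if x ∈ S then 1 else 0)) u :=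
      fun y hy hyS => by
        have := h y (by simp [hy]) hyS
        rwa [mem_serving_cons (ne_of_mem_of_not_mem hy hcs.1)] at this
    obtain ⟨h₁, h₂⟩ := ih hcs.2 hu
    have hx := fun hxS => (self_mem_serving_cons hcs.1).1 (h x (by simp) hxS)
    have hc : c + 1 + (if x ∈ A then 1 else 0) - (if x ∈ S then 1 else 0) =
        c + (if x ∈ A then 1 else 0) - (if x ∈ S then 1 else 0) + 1 := by
      by_cases hxS : x ∈ S
      · have := (hx hxS).2
        simp only [hxS, if_true]
        omega
      · simp only [hxS, if_false]
        omega
    simp only [queueEnd, serving, hc, h₁, h₂, true_and]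
    congr 1
    by_cases hxS : x ∈ S
    · have h0 := (hx hxS).2
      have h1 : 0 < c + 1 + (if x ∈ A then 1 else 0) := by omega
      simp only [hxS, h0, h1]
    · simp only [hxS, false_and]

/-- One more member in the queue is served by the first ball of `S` that is free otherwise. -/
theorem serving_succ_of_free {c d : ℕ} {cs : List ℕ} (hcs : cs.Pairwise (· < ·))
    (hd : d ∈ cs) (hS : d ∈ S) (hf : d ∉ serving A S c cs)
    (hmin : ∀ x ∈ cs, x ∈ S → x ∉ serving A S c cs → d ≤ x) :
    queueEnd A S (c + 1) cs = queueEnd A S c cs ∧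
      serving A S (c + 1) cs = insert d (serving A S c cs) := by
  induction cs generalizing c with
  | nil => simp at hd
  | cons x u ih =>
    rw [List.pairwise_cons] at hcs
    have hxu : x ∉ u := fun h => lt_irrefl _ (hcs.1 x h)
    by_cases hx : x ∈ S ∧ c + (if x ∈ A then 1 else 0) = 0
    · have hxf : x ∉ serving A S c (x :: u) := by
        rw [self_mem_serving_cons hxu]
        omega
      have hdx : d = x := by
        rcases List.mem_cons.1 hd with h | h
        · exact h
        · exact absurd (hmin x (by simp) hx.1 hxf) (hcs.1 d h).not_ge
      subst hdx
      have h0 : c = 0 := by omega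
      have hA : d ∉ A := fun h => by simp [h] at hx
      subst h0
      simp only [queueEnd, serving, hx.1, hA, if_true, if_false]
      simp
    · have hdx : d ≠ x := by
        rintro rfl
        rw [self_mem_serving_cons hxu] at hf
        exact hx ⟨hS, Nat.eq_zero_of_not_pos fun h => hf ⟨hS, h⟩⟩
      have hdu := (List.mem_cons.1 hd).resolve_left hdx
      rw [mem_serving_cons hdx] at hf
      obtain ⟨h₁, h₂⟩ := ih hcs.2 hdu hf fun y hy hyS hyf =>
        hmin y (by simp [hy]) hyS (by rwa [mem_serving_cons (ne_of_mem_of_not_mem hy hxu)])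
      have hc : c + 1 + (if x ∈ A then 1 else 0) - (if x ∈ S then 1 else 0) =
          c + (if x ∈ A then 1 else 0) - (if x ∈ S then 1 else 0) + 1 := by
        by_cases hxS : x ∈ S
        · simp only [hxS, true_and] at hx
          simp only [hxS, if_true]
          omega
        · simp only [hxS, if_false]
          omega
      simp only [queueEnd, serving, hc, h₁, h₂, true_and]
      rw [Finset.union_insert]
      congr 2
      by_cases hxS : x ∈ S
      · simp only [hxS, true_and] at hx
        have h0 : 0 < c + (if x ∈ A then 1 else 0) := by omega
        have h1 : 0 < c + 1 + (if x ∈ A then 1 else 0) := by omega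
        simp only [hxS, h0, h1]
      · simp only [hxS, false_and]

theorem countP_mem_eq_card {cs : List ℕ} (hcs : cs.Nodup) (hA : ∀ x ∈ A, x ∈ cs) :
    cs.countP (· ∈ A) = A.card := by
  rw [List.countP_eq_length_filter, ← List.toFinset_card_of_nodup (hcs.filter _)]
  congr 1
  ext x
  simpa using hA x

/-- Starting the queue with the balls that wrap around, the same number is left at the end. -/
theorem queueEnd_wraps {cs : List ℕ} (hcs : cs.Nodup) (hA : ∀ x ∈ A, x ∈ cs)
    (hS : ∀ x ∈ S, x ∈ cs) (h : A.card ≤ S.card) :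
    queueEnd A S (wraps cs A S) cs = wraps cs A S := by
  by_cases hf : ∃ d ∈ S, d ∉ serving A S (wraps cs A S) cs
  · obtain ⟨d, hd, hf⟩ := hf
    exact queueEnd_eq_of_free (Nat.zero_le _) hcs (hS d hd) hd hf
  · push Not at hf
    have h₁ := card_serving (A := A) (S := S) hcs (wraps cs A S)
    rw [countP_mem_eq_card hcs hA] at h₁
    have h₂ := Finset.card_le_card (show S ⊆ _ from hf)
    have h₃ : wraps cs A S ≤ queueEnd A S (wraps cs A S) cs := queueEnd_mono (Nat.zero_le _) cs
    omega

theorem targets_subset (cs : List ℕ) (A S : Finset ℕ) : targets cs A S ⊆ S :=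
  fun _ h => (mem_of_mem_serving h).1

theorem card_targets {cs : List ℕ} (hcs : cs.Nodup) (hA : ∀ x ∈ A, x ∈ cs)
    (hS : ∀ x ∈ S, x ∈ cs) (h : A.card ≤ S.card) : (targets cs A S).card = A.card := by
  have h₁ := card_serving (A := A) (S := S) hcs (wraps cs A S)
  rw [countP_mem_eq_card hcs hA, queueEnd_wraps hcs hA hS h] at h₁
  unfold targets
  omega

theorem queueEnd_empty (S : Finset ℕ) (cs : List ℕ) : queueEnd ∅ S 0 cs = 0 := by
  induction cs with
  | nil => rfl
  | cons x u ih => simpa [queueEnd] using ih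

theorem serving_empty (S : Finset ℕ) (cs : List ℕ) : serving ∅ S 0 cs = ∅ := by
  induction cs with
  | nil => rfl
  | cons x u ih => simpa [serving] using ih

theorem wraps_empty (cs : List ℕ) (S : Finset ℕ) : wraps cs ∅ S = 0 := queueEnd_empty S cs

theorem targets_empty (cs : List ℕ) (S : Finset ℕ) : targets cs ∅ S = ∅ := by
  rw [targets, wraps_empty, serving_empty]

theorem cyclicNext_eq_of_le {R : Finset ℕ} {a d : ℕ} (hd : d ∈ R) (had : a ≤ d)
    (hmin : ∀ x ∈ R, a ≤ x → d ≤ x) : cyclicNext R a = some d := by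
  have hne : (R.filter fun x => a ≤ x).Nonempty := ⟨d, by simp [hd, had]⟩
  rw [cyclicNext, dif_pos hne, Option.some_inj]
  refine le_antisymm (Finset.min'_le _ _ (by simp [hd, had])) (Finset.le_min' _ _ _ fun x hx => ?_)
  rw [Finset.mem_filter] at hx
  exact hmin x hx.1 hx.2

theorem cyclicNext_eq_of_lt {R : Finset ℕ} {a d : ℕ} (hd : d ∈ R) (hlt : ∀ x ∈ R, x < a)
    (hmin : ∀ x ∈ R, d ≤ x) : cyclicNext R a = some d := by
  have he : ¬ (R.filter fun x => a ≤ x).Nonempty := by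
    rintro ⟨x, hx⟩
    rw [Finset.mem_filter] at hx
    exact absurd hx.2 (hlt x hx.1).not_ge
  rw [cyclicNext, dif_neg he, dif_pos ⟨d, hd⟩, Option.some_inj]
  exact le_antisymm (Finset.min'_le _ _ hd) (Finset.le_min' _ _ _ hmin)

/-- When one more ball `a` is paired after the balls of `A`, it takes the first free ball weakly to
its right, cyclically. Hence the balls of a row can be paired in any order. -/
theorem targets_insert {cs : List ℕ} (hcs : cs.Pairwise (· < ·)) (hA : ∀ x ∈ A, x ∈ cs)
    (hS : ∀ x ∈ S, x ∈ cs) {a : ℕ} (ha : a ∈ cs) (haA : a ∉ A) (h : A.card < S.card) :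
    ∃ d ∈ S, d ∉ targets cs A S ∧ cyclicNext (S \ targets cs A S) a = some d ∧
      targets cs (insert a A) S = insert d (targets cs A S) ∧
      wraps cs (insert a A) S = wraps cs A S + if d < a then 1 else 0 := by
  have hnd : cs.Nodup := hcs.imp fun h => h.ne
  have hfix := queueEnd_wraps hnd hA hS h.le
  have hcard := card_targets hnd hA hS h.le
  obtain ⟨u, v, rfl⟩ := List.append_of_mem ha
  rw [List.pairwise_append] at hcs
  obtain ⟨hu, hv, huv⟩ := hcs
  have hau : a ∉ u := fun h => lt_irrefl _ (huv a h a (by simp))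
  have hav : a ∉ v := fun h => lt_irrefl _ ((List.pairwise_cons.1 hv).1 a h)
  have hle : ∀ x ∈ a :: v, a ≤ x := by
    intro x hx
    rcases List.mem_cons.1 hx with rfl | hx
    · exact le_rfl
    · exact ((List.pairwise_cons.1 hv).1 x hx).le
  have hvn : (a :: v).Nodup := hv.imp fun h => h.ne
  have hun : u.Nodup := hu.imp fun h => h.ne
  -- The additional ball lengthens the queue from column `a` on.
  have e₁ : ∀ c, queueEnd (insert a A) S c (u ++ a :: v) =
      queueEnd A S (queueEnd A S c u + 1) (a :: v) := by
    intro c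
    rw [queueEnd_append, queueEnd_congr (A' := A) (cs := u) (fun x hx => by
      simp only [Finset.mem_insert, or_iff_right_iff_imp]
      rintro rfl
      exact absurd hx hau)]
    simp only [queueEnd, Finset.mem_insert_self, haA, if_true, if_false, add_zero]
    exact queueEnd_congr (fun x hx => by
      simp only [Finset.mem_insert, or_iff_right_iff_imp]
      rintro rfl
      exact absurd hx hav) _
  have e₂ : ∀ c, serving (insert a A) S c (u ++ a :: v) =
      serving A S c u ∪ serving A S (queueEnd A S c u + 1) (a :: v) := by
    intro c
    have hu' : ∀ x ∈ u, x ∈ insert a A ↔ x ∈ A := fun x hx => by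
      simp only [Finset.mem_insert, or_iff_right_iff_imp]
      rintro rfl
      exact absurd hx hau
    rw [serving_append, serving_congr hu', queueEnd_congr hu']
    simp only [serving, Finset.mem_insert_self, haA, if_true, if_false, add_zero]
    congr 2
    exact serving_congr (fun x hx => by
      simp only [Finset.mem_insert, or_iff_right_iff_imp]
      rintro rfl
      exact absurd hx hav) _
  unfold targets at hcard ⊢
  set q := wraps (u ++ a :: v) A S with hq
  have hq' : queueEnd A S (queueEnd A S 0 u) (a :: v) = q := by
    rw [← queueEnd_append, hq, wraps]
  rw [queueEnd_append] at hfix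
  set e := queueEnd A S q u with he
  have he0 : queueEnd A S 0 u ≤ e := queueEnd_mono (Nat.zero_le _) u
  have hT : serving A S q (u ++ a :: v) = serving A S q u ∪ serving A S e (a :: v) :=
    serving_append _ _ _
  have hmu : ∀ x ∈ u, x ∈ serving A S q (u ++ a :: v) ↔ x ∈ serving A S q u := fun x hx => by
    rw [hT, Finset.mem_union, or_iff_left_iff_imp]
    intro h
    exact absurd (hle x (mem_of_mem_serving h).2) (huv x hx a (by simp)).not_ge
  have hmv : ∀ x ∈ a :: v, x ∈ serving A S q (u ++ a :: v) ↔ x ∈ serving A S e (a :: v) :=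
    fun x hx => by
      rw [hT, Finset.mem_union, or_iff_right_iff_imp]
      intro h
      exact absurd (hle x hx) (huv x (mem_of_mem_serving h).2 a (by simp)).not_ge
  by_cases hfree : ((S \ serving A S e (a :: v)).filter (· ∈ a :: v)).Nonempty
  · obtain ⟨d, hd, hmin⟩ := Finset.exists_min_image _ id hfree
    simp only [Finset.mem_filter, Finset.mem_sdiff, id] at hd hmin
    obtain ⟨⟨hdS, hdf⟩, hdv⟩ := hd
    obtain ⟨h₁, h₂⟩ := serving_succ_of_free hv hdv hdS hdf
      fun x hx hxS hxf => hmin x ⟨⟨hxS, hxf⟩, hx⟩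
    have hdT := mt (hmv d hdv).1 hdf
    have hw : wraps (u ++ a :: v) (insert a A) S = q := by
      have h₃ := queueEnd_mono (A := A) (S := S) (Nat.le_succ (queueEnd A S 0 u)) (a :: v)
      have h₄ := queueEnd_mono (A := A) (S := S) (Nat.succ_le_succ he0) (a :: v)
      rw [wraps, e₁]
      simp only [Nat.succ_eq_add_one] at h₃ h₄
      omega
    refine ⟨d, hdS, hdT, cyclicNext_eq_of_le (by simp [hdS, hdT]) (hle d hdv) ?_, ?_, ?_⟩
    · intro x hx hax
      rw [Finset.mem_sdiff] at hx
      have hxv : x ∈ a :: v := by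
        rcases List.mem_append.1 (hS x hx.1) with h | h
        · exact absurd hax (huv x h a (by simp)).not_ge
        · exact h
      exact hmin x ⟨⟨hx.1, mt (hmv x hxv).2 hx.2⟩, hxv⟩
    · rw [hw, e₂, h₂, hT, Finset.union_insert]
    · rw [hw, if_neg (hle d hdv).not_gt, add_zero]
  · -- All balls of `S` weakly to the right of `a` are taken, so some ball to the left is free.
    rw [Finset.not_nonempty_iff_eq_empty] at hfree
    have hfull : ∀ x ∈ a :: v, x ∈ S → x ∈ serving A S e (a :: v) := by
      intro x hx hxS
      by_contra hxf
      have : x ∈ (S \ serving A S e (a :: v)).filter (· ∈ a :: v) := by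
        rw [Finset.mem_filter, Finset.mem_sdiff]
        exact ⟨⟨hxS, hxf⟩, hx⟩
      rw [hfree] at this
      simp at this
    obtain ⟨h₁, h₂⟩ := serving_succ_of_full hvn hfull
    have hne : (S \ serving A S q (u ++ a :: v)).Nonempty := by
      rw [Finset.sdiff_nonempty]
      intro hsub
      have := Finset.card_le_card hsub
      omega
    obtain ⟨d, hd, hmin⟩ := Finset.exists_min_image _ id hne
    simp only [Finset.mem_sdiff, id] at hd hmin
    obtain ⟨hdS, hdT⟩ := hd
    have hR : ∀ x ∈ S, x ∉ serving A S q (u ++ a :: v) → x ∈ u := by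
      intro x hx hxT
      rcases List.mem_append.1 (hS x hx) with h | h
      · exact h
      · exact absurd ((hmv x h).2 (hfull x h hx)) hxT
    have hdu := hR d hdS hdT
    have hdf := mt (hmu d hdu).2 hdT
    obtain ⟨h₃, h₄⟩ := serving_succ_of_free hu hdu hdS hdf
      fun x hx hxS hxf => hmin x ⟨hxS, mt (hmu x hx).1 hxf⟩
    have h₅ : e = queueEnd A S 0 u := queueEnd_eq_of_free (Nat.zero_le _) hun hdu hdS hdf
    have hw : wraps (u ++ a :: v) (insert a A) S = q + 1 := by
      rw [wraps, e₁, ← h₅, h₁, hfix]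
    have hda : d < a := huv d hdu a (by simp)
    refine ⟨d, hdS, hdT, cyclicNext_eq_of_lt (by simp [hdS, hdT]) ?_ ?_, ?_, ?_⟩
    · intro x hx
      rw [Finset.mem_sdiff] at hx
      exact huv x (hR x hx.1 hx.2) a (by simp)
    · intro x hx
      rw [Finset.mem_sdiff] at hx
      exact hmin x hx
    · rw [hw, e₂, h₃, ← he, h₂, h₄, hT, Finset.insert_union]
    · rw [hw, if_pos hda]

theorem pairBalls_append (S : Finset ℕ) (l l' : List ℕ) :
    pairBalls S (l ++ l') =
      pairBalls S l ++ pairBalls (S \ ((pairBalls S l).map Prod.snd).toFinset) l' := by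
  induction l generalizing S with
  | nil => simp [pairBalls]
  | cons c l ih =>
    simp only [List.cons_append, pairBalls]
    split
    next d _ =>
      rw [ih, List.cons_append]
      congr 3
      ext x
      simp only [Finset.mem_sdiff, Finset.mem_erase, List.map_cons, List.toFinset_cons,
        Finset.mem_insert]
      tauto
    next => exact ih S

/-- The pairing process, in whatever order, has the targets and the wrappings that are
computed by the queue. -/
theorem pairBalls_spec {cs : List ℕ} (hcs : cs.Pairwise (· < ·)) (hS : ∀ x ∈ S, x ∈ cs)
    {l : List ℕ} (hl : l.Nodup) (hlcs : ∀ x ∈ l, x ∈ cs) (hcard : l.length ≤ S.card) :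
    (pairBalls S l).map Prod.fst = l ∧
      ((pairBalls S l).map Prod.snd).toFinset = targets cs l.toFinset S ∧
      ((pairBalls S l).map Prod.snd).Nodup ∧
      (pairBalls S l).countP (fun p => p.2 < p.1) = wraps cs l.toFinset S := by
  induction l using List.reverseRecOn with
  | nil => simp [pairBalls, targets_empty, wraps_empty]
  | append_singleton l a ih =>
    rw [List.length_append, List.length_singleton] at hcard
    obtain ⟨hl₁, -, hl₂⟩ := List.nodup_append.1 hl
    have hal : a ∉ l := fun h => hl₂ a h a (by simp) rfl
    obtain ⟨h₁, h₂, h₃, h₄⟩ := ih hl₁ (fun x hx => hlcs x (by simp [hx])) (by omega)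
    obtain ⟨d, -, hdT, hn, ht, hw⟩ := targets_insert (A := l.toFinset) hcs
      (fun x hx => hlcs x (by simp [List.mem_toFinset.1 hx])) hS (hlcs a (by simp)) (by simpa)
      (by rw [List.toFinset_card_of_nodup hl₁]; omega)
    have hp : pairBalls S (l ++ [a]) = pairBalls S l ++ [(a, d)] := by
      rw [pairBalls_append, h₂]
      simp [pairBalls, hn]
    have hla : (l ++ [a]).toFinset = insert a l.toFinset := by
      ext x
      simp
    rw [hp, hla]
    refine ⟨by simp [h₁], ?_, ?_, ?_⟩
    · rw [ht, ← h₂]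
      ext x
      simp
    · rw [List.map_append, List.nodup_append]
      refine ⟨h₃, by simp, ?_⟩
      intro x hx y hy hxy
      rw [List.map_singleton, List.mem_singleton] at hy
      rw [← h₂, List.mem_toFinset] at hdT
      rw [hxy, show y = d from hy] at hx
      exact hdT hx
    · rw [List.countP_append, h₄, hw]
      simp [List.countP_cons]

/-- Any ball `a` of `A` may be paired first. -/
theorem targets_eq_insert {cs : List ℕ} (hcs : cs.Pairwise (· < ·)) (hA : ∀ x ∈ A, x ∈ cs)
    (hS : ∀ x ∈ S, x ∈ cs) (h : A.card ≤ S.card) {a : ℕ} (ha : a ∈ A) :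
    ∃ d ∈ S, cyclicNext S a = some d ∧
      targets cs A S = insert d (targets cs (A.erase a) (S.erase d)) ∧
      wraps cs A S = wraps cs (A.erase a) (S.erase d) + if d < a then 1 else 0 := by
  have hS0 : 0 < S.card := (Finset.card_pos.2 ⟨a, ha⟩).trans_le h
  obtain ⟨d, hdS, -, hn, -, -⟩ := targets_insert (A := ∅) hcs (by simp) hS (hA a ha) (by simp)
    (by simpa using hS0)
  rw [targets_empty, Finset.sdiff_empty] at hn
  refine ⟨d, hdS, hn, ?_⟩
  have hc₁ := Finset.card_erase_of_mem ha
  have hc₂ := Finset.card_erase_of_mem hdS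
  obtain ⟨-, h₂, -, h₄⟩ := pairBalls_spec (S := S) (l := a :: (A.erase a).toList) hcs hS
    (by simp [Finset.nodup_toList]) (by simpa [hA a ha] using fun x _ hx => hA x hx)
    (by simp only [List.length_cons, Finset.length_toList]; omega)
  obtain ⟨-, k₂, -, k₄⟩ := pairBalls_spec (S := S.erase d) (l := (A.erase a).toList) hcs
    (fun x hx => hS x (Finset.mem_of_mem_erase hx)) (Finset.nodup_toList _)
    (by simpa using fun x _ hx => hA x hx) (by rw [Finset.length_toList]; omega)
  have hp : pairBalls S (a :: (A.erase a).toList) =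
      (a, d) :: pairBalls (S.erase d) (A.erase a).toList := by
    simp [pairBalls, hn]
  rw [hp] at h₂ h₄
  simp only [List.map_cons, List.toFinset_cons, Finset.toList_toFinset, Finset.insert_erase ha,
    List.countP_cons, decide_eq_true_eq] at h₂ h₄ k₂ k₄
  exact ⟨by rw [← h₂, k₂], by rw [← h₄, k₄]⟩

end Queue

/-! ### The energies of an arrangement of balls -/

/-- The number of wrapping pairings when the balls of `A`, placed in row `k + 1`, are paired with
row `k`, their targets with row `k - 1`, and so on. -/
def rowEnergy (cs : List ℕ) (M : Rows) : ℕ → Finset ℕ → ℕ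
  | 0, _ => 0
  | k + 1, A => wraps cs A (M (k + 1)) + rowEnergy cs M k (targets cs A (M (k + 1)))

/-- The rows of the balls in column `x`, from row `K` downwards. -/
def columnWord (M : Rows) (x : ℕ) : ℕ → List ℕ
  | 0 => []
  | K + 1 => (if x ∈ M (K + 1) then [K + 1] else []) ++ columnWord M x K

/-- The column reading word of the rows `1, …, K`: columns from left to right, each from top to
bottom. -/
def arrWord (cs : List ℕ) (K : ℕ) (M : Rows) : List ℕ := cs.flatMap fun x => columnWord M x K

theorem arrWord_cons (x : ℕ) (cs : List ℕ) (K : ℕ) (M : Rows) :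
    arrWord (x :: cs) K M = columnWord M x K ++ arrWord cs K M := rfl

theorem columnWord_congr {M M' : Rows} {x K : ℕ}
    (h : ∀ k, 1 ≤ k → k ≤ K → (x ∈ M k ↔ x ∈ M' k)) : columnWord M x K = columnWord M' x K := by
  induction K with
  | zero => rfl
  | succ K ih =>
    simp only [columnWord, h (K + 1) (by omega) le_rfl]
    rw [ih fun k h₁ h₂ => h k h₁ (by omega)]

theorem arrWord_congr {M M' : Rows} {cs : List ℕ} {K : ℕ}
    (h : ∀ x ∈ cs, ∀ k, 1 ≤ k → k ≤ K → (x ∈ M k ↔ x ∈ M' k)) :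
    arrWord cs K M = arrWord cs K M' := by
  induction cs with
  | nil => rfl
  | cons x cs ih =>
    rw [arrWord_cons, arrWord_cons, columnWord_congr (h x (by simp)),
      ih fun y hy => h y (by simp [hy])]

theorem rowEnergy_congr {M M' : Rows} {k : ℕ} (h : ∀ j, 1 ≤ j → j ≤ k → M j = M' j) (cs : List ℕ)
    (A : Finset ℕ) : rowEnergy cs M k A = rowEnergy cs M' k A := by
  induction k generalizing A with
  | zero => rfl
  | succ k ih =>
    simp only [rowEnergy, h (k + 1) (by omega) le_rfl]
    rw [ih fun j h₁ h₂ => h j h₁ (by omega)]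

theorem queueLength_columnWord_of_lt {r K : ℕ} (h : K < r) (M : Rows) (x c : ℕ) (u : List ℕ) :
    queueLength r c (columnWord M x K ++ u) = queueLength r c u := by
  induction K with
  | zero => rfl
  | succ K ih =>
    have h₁ : K + 1 ≠ r + 1 := by omega
    rw [columnWord, List.append_assoc]
    split_ifs
    · simp only [List.singleton_append, queueLength, h₁, h.ne, if_false]
      exact ih (by omega)
    · exact ih (by omega)

theorem keepServing_columnWord_of_lt {r K : ℕ} (h : K < r) (M : Rows) (x c : ℕ) (u : List ℕ) :
    keepServing r c (columnWord M x K ++ u) = columnWord M x K ++ keepServing r c u := by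
  induction K with
  | zero => rfl
  | succ K ih =>
    rw [columnWord, List.append_assoc, List.append_assoc]
    split_ifs
    · rw [List.singleton_append, keepServing_cons_of_lt h, ih (by omega), List.singleton_append]
    · exact ih (by omega)

theorem queueLength_columnWord {r K : ℕ} (hr : 0 < r) (hK : r + 1 ≤ K) (M : Rows) (x c : ℕ)
    (u : List ℕ) : queueLength r c (columnWord M x K ++ u) =
      queueLength r (c + (if x ∈ M (r + 1) then 1 else 0) - (if x ∈ M r then 1 else 0)) u := by
  induction K, hK using Nat.le_induction with
  | base =>
    obtain ⟨s, rfl⟩ := Nat.exists_eq_succ_of_ne_zero hr.ne'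
    have h₁ := fun c => queueLength_columnWord_of_lt (Nat.lt_succ_self s) M x c u
    simp only [Nat.succ_eq_add_one] at h₁
    simp only [columnWord, Nat.succ_eq_add_one]
    split_ifs <;> simp [queueLength, h₁]
  | succ K hK ih =>
    have h₁ : K + 1 ≠ r + 1 := by omega
    have h₂ : K + 1 ≠ r := by omega
    rw [columnWord, List.append_assoc]
    by_cases hx : x ∈ M (K + 1)
    · rw [if_pos hx, List.singleton_append, queueLength, if_neg h₁, if_neg h₂, ih]
    · rw [if_neg hx, List.nil_append, ih]

theorem keepServing_columnWord {r K : ℕ} (hK : r + 2 ≤ K) (M : Rows) (x c : ℕ) (u : List ℕ) :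
    keepServing (r + 1) c (columnWord M x K ++ u) =
      ((if x ∈ M (r + 1) ∧ 0 < c + (if x ∈ M (r + 2) then 1 else 0) then [r + 1] else []) ++
        columnWord M x r) ++ keepServing (r + 1)
          (c + (if x ∈ M (r + 2) then 1 else 0) - (if x ∈ M (r + 1) then 1 else 0)) u := by
  induction K, hK using Nat.le_induction with
  | base =>
    have h₁ := fun c => keepServing_columnWord_of_lt (Nat.lt_succ_self r) M x c u
    simp only [Nat.succ_eq_add_one] at h₁
    simp only [columnWord]
    by_cases h₂ : x ∈ M (r + 2) <;> by_cases h₃ : x ∈ M (r + 1) <;>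
      simp only [h₂, h₃, if_true, if_false, List.cons_append, List.nil_append,
        keepServing_succ_cons, keepServing_self_cons, h₁, true_and, false_and,
        Nat.succ_pos, add_zero, Nat.add_sub_cancel, Nat.sub_zero]
    rcases Nat.eq_zero_or_pos c with rfl | hc
    · simp
    · simp [hc]
  | succ K hK ih =>
    have h₁ : r + 1 + 1 < K + 1 := by omega
    rw [columnWord, List.append_assoc]
    by_cases hx : x ∈ M (K + 1)
    · rw [if_pos hx, List.singleton_append, keepServing_cons_of_gt h₁, ih]
    · rw [if_neg hx, List.nil_append, ih]

theorem queueLength_arrWord {r K : ℕ} (hr : 0 < r) (hK : r + 1 ≤ K) (M : Rows) (c : ℕ)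
    (cs : List ℕ) : queueLength r c (arrWord cs K M) = queueEnd (M (r + 1)) (M r) c cs := by
  induction cs generalizing c with
  | nil => rfl
  | cons x cs ih => rw [arrWord_cons, queueLength_columnWord hr hK, ih, queueEnd]

theorem keepServing_arrWord {r K : ℕ} (hK : r + 2 ≤ K) (M : Rows) (c : ℕ) {cs : List ℕ}
    (hcs : cs.Nodup) : keepServing (r + 1) c (arrWord cs K M) =
      arrWord cs (r + 1) (Function.update M (r + 1) (serving (M (r + 2)) (M (r + 1)) c cs)) := by
  induction cs generalizing c with
  | nil => rfl
  | cons x cs ih =>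
    rw [List.nodup_cons] at hcs
    rw [arrWord_cons, keepServing_columnWord hK, ih _ hcs.2, arrWord_cons, columnWord]
    congr 1
    · congr 1
      · simp only [Function.update_self, self_mem_serving_cons hcs.1]
      · refine columnWord_congr fun k _ hk => ?_
        rw [Function.update_of_ne (by omega)]
    · refine arrWord_congr fun y hy k _ _ => ?_
      by_cases hk : k = r + 1
      · subst hk
        rw [Function.update_self, Function.update_self,
          mem_serving_cons (ne_of_mem_of_not_mem hy hcs.1)]
      · rw [Function.update_of_ne hk, Function.update_of_ne hk]

theorem energy_arrWord {k K : ℕ} (hK : k < K) (M : Rows) {cs : List ℕ} (hcs : cs.Nodup) :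
    energy k (arrWord cs K M) = rowEnergy cs M k (M (k + 1)) := by
  induction k generalizing K M with
  | zero => rfl
  | succ k ih =>
    rw [energy, rowEnergy, queueLength_arrWord k.succ_pos (by omega),
      keepServing_arrWord (by omega) _ _ hcs, ih (by omega)]
    congr 1
    rw [Function.update_self]
    refine rowEnergy_congr (fun j _ hj => ?_) _ _
    rw [Function.update_of_ne (by omega)]

/-! ### The major index as a sum of energies -/

theorem mem_pairingOrder {L : ℕ} {A : Finset ℕ} {lab : ℕ → ℕ} (hlab : ∀ c, lab c ≤ L) {c : ℕ} :
    c ∈ pairingOrder L A lab ↔ c ∈ A := by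
  simp only [pairingOrder, List.mem_flatMap, List.mem_reverse, List.mem_range, Finset.mem_sort,
    Finset.mem_filter]
  exact ⟨fun ⟨l, _, h, _⟩ => h, fun h => ⟨lab c, Nat.lt_succ_of_le (hlab c), h, rfl⟩⟩

theorem nodup_pairingOrder (L : ℕ) (A : Finset ℕ) (lab : ℕ → ℕ) :
    (pairingOrder L A lab).Nodup := by
  rw [pairingOrder, List.nodup_flatMap]
  refine ⟨fun l _ => Finset.sort_nodup _ _, ?_⟩
  refine (List.nodup_reverse.2 List.nodup_range).imp fun hne c h₁ h₂ => ?_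
  simp only [Finset.mem_sort, Finset.mem_filter] at h₁ h₂
  exact hne (h₁.2.symm.trans h₂.2)

/-- The balls with label at least `l` are paired before the others. -/
theorem exists_pairingOrder_split {L l : ℕ} (hl : l ≤ L + 1) (A : Finset ℕ) {lab : ℕ → ℕ}
    (hlab : ∀ c, lab c ≤ L) : ∃ hi lo, pairingOrder L A lab = hi ++ lo ∧
      hi.toFinset = A.filter (fun c => l ≤ lab c) ∧ ∀ c ∈ lo, lab c < l := by
  refine ⟨((List.range (L + 1 - l)).map (l + ·)).reverse.flatMap fun i =>
      (A.filter fun c => lab c = i).sort (· ≤ ·),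
    (List.range l).reverse.flatMap fun i => (A.filter fun c => lab c = i).sort (· ≤ ·),
    ?_, ?_, ?_⟩
  · rw [← List.flatMap_append, ← List.reverse_append, ← List.range_add, Nat.add_sub_cancel' hl,
      pairingOrder]
  · ext c
    simp only [List.mem_toFinset, List.mem_flatMap, List.mem_reverse, List.mem_map, List.mem_range,
      Finset.mem_sort, Finset.mem_filter]
    constructor
    · rintro ⟨_, ⟨i, _, rfl⟩, hc, h⟩
      exact ⟨hc, by omega⟩
    · rintro ⟨hc, h⟩
      have := hlab c
      exact ⟨lab c, ⟨lab c - l, by omega, by omega⟩, hc, rfl⟩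
  · intro c hc
    simp only [List.mem_flatMap, List.mem_reverse, List.mem_range, Finset.mem_sort,
      Finset.mem_filter] at hc
    obtain ⟨i, hi, -, h⟩ := hc
    omega

theorem fmLabel_of_lt {L r : ℕ} (h : r < L) (M : Rows) (d : ℕ) :
    fmLabel L M r d = match (fmPairs L M (r + 1)).find? (fun p => p.2 = d) with
      | some p => fmLabel L M (r + 1) p.1
      | none => r := by
  rw [fmLabel, if_pos h]
  rfl

theorem fmLabel_mem_Icc {L r : ℕ} (h : r ≤ L) (M : Rows) (d : ℕ) :
    r ≤ fmLabel L M r d ∧ fmLabel L M r d ≤ L := by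
  induction h using Nat.decreasingInduction generalizing d with
  | of_succ r h ih =>
    rw [fmLabel_of_lt h]
    split
    next p _ => have := ih p.1; omega
    next => omega
  | self => rw [fmLabel, if_neg (lt_irrefl L)]; simp

/-- The balls of row `r` with label at least `l`. -/
def labelGE (L : ℕ) (M : Rows) (r l : ℕ) : Finset ℕ := (M r).filter fun c => l ≤ fmLabel L M r c

theorem labelGE_self {L r : ℕ} (h : r ≤ L) (M : Rows) : labelGE L M r r = M r := by
  rw [labelGE, Finset.filter_true_of_mem]
  exact fun c _ => (fmLabel_mem_Icc h M c).1

section Energy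

variable {L : ℕ} {M : Rows} {cs : List ℕ}

/-- The pairings of the balls with label at least `l` form an initial segment of the pairings that
originate from a row, to which the description of the pairings by a queue applies. -/
theorem fmPairs_split (hcs : cs.Pairwise (· < ·)) (hM : ∀ j, ∀ x ∈ M (j + 1), x ∈ cs)
    (hcard : ∀ j, (M (j + 2)).card ≤ (M (j + 1)).card) {r l : ℕ} (hr : r + 2 ≤ L)
    (hl : l ≤ L + 1) : ∃ P Q, fmPairs L M (r + 2) = P ++ Q ∧
      ((P ++ Q).map Prod.snd).Nodup ∧
      (∀ p ∈ P, l ≤ fmLabel L M (r + 2) p.1) ∧ (∀ p ∈ Q, fmLabel L M (r + 2) p.1 < l) ∧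
      (P.map Prod.snd).toFinset = targets cs (labelGE L M (r + 2) l) (M (r + 1)) ∧
      P.countP (fun p => p.2 < p.1) = wraps cs (labelGE L M (r + 2) l) (M (r + 1)) := by
  have hlab : ∀ c, fmLabel L M (r + 2) c ≤ L := fun c => (fmLabel_mem_Icc hr M c).2
  obtain ⟨hi, lo, h₁, h₂, h₃⟩ := exists_pairingOrder_split hl (M (r + 2)) hlab
  have hnd := nodup_pairingOrder L (M (r + 2)) (fmLabel L M (r + 2))
  have hmem : ∀ c ∈ pairingOrder L (M (r + 2)) (fmLabel L M (r + 2)), c ∈ cs :=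
    fun c hc => hM (r + 1) c ((mem_pairingOrder hlab).1 hc)
  have hlen : (pairingOrder L (M (r + 2)) (fmLabel L M (r + 2))).length ≤ (M (r + 1)).card := by
    rw [← List.toFinset_card_of_nodup hnd]
    refine (Finset.card_le_card fun c hc => ?_).trans (hcard r)
    exact (mem_pairingOrder hlab).1 (List.mem_toFinset.1 hc)
  obtain ⟨s₁, -, s₃, -⟩ := pairBalls_spec hcs (hM r) hnd hmem hlen
  have hp : fmPairs L M (r + 2) =
      pairBalls (M (r + 1)) (pairingOrder L (M (r + 2)) (fmLabel L M (r + 2))) := rfl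
  rw [h₁] at hnd hmem hlen
  obtain ⟨t₁, t₂, -, t₄⟩ := pairBalls_spec (l := hi) hcs (hM r) (List.nodup_append.1 hnd).1
    (fun c hc => hmem c (by simp [hc])) (by rw [List.length_append] at hlen; omega)
  rw [h₁, pairBalls_append] at s₁ s₃
  rw [List.map_append, t₁, List.append_cancel_left_eq] at s₁
  refine ⟨_, _, by rw [hp, h₁, pairBalls_append], s₃, ?_, ?_, ?_, ?_⟩
  · intro p hp
    have hp' : p.1 ∈ hi := t₁ ▸ List.mem_map_of_mem hp
    rw [← List.mem_toFinset, h₂, Finset.mem_filter] at hp'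
    exact hp'.2
  · intro p hp
    exact h₃ p.1 (s₁ ▸ List.mem_map_of_mem hp)
  · rw [t₂, h₂, labelGE]
  · rw [t₄, h₂, labelGE]

theorem find?_eq_some_of_nodup {P : List (ℕ × ℕ)} (h : (P.map Prod.snd).Nodup) {p : ℕ × ℕ}
    (hp : p ∈ P) : P.find? (fun q => q.2 = p.2) = some p := by
  induction P with
  | nil => simp at hp
  | cons q P ih =>
    rw [List.map_cons, List.nodup_cons] at h
    rcases List.mem_cons.1 hp with rfl | hp
    · simp
    · have hne : q.2 ≠ p.2 := fun he => h.1 (he ▸ List.mem_map_of_mem hp)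
      rw [List.find?_cons_of_neg (by simpa using hne), ih h.2 hp]

/-- The balls with label at least `l` in consecutive rows are related by cyclic pairing. -/
theorem labelGE_eq_targets (hcs : cs.Pairwise (· < ·)) (hM : ∀ j, ∀ x ∈ M (j + 1), x ∈ cs)
    (hcard : ∀ j, (M (j + 2)).card ≤ (M (j + 1)).card) {r l : ℕ} (hr : r + 2 ≤ l) (hl : l ≤ L) :
    labelGE L M (r + 1) l = targets cs (labelGE L M (r + 2) l) (M (r + 1)) := by
  obtain ⟨P, Q, hPQ, hnd, hP, hQ, ht, -⟩ :=
    fmPairs_split (L := L) hcs hM hcard (r := r) (l := l) (by omega) (by omega)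
  ext d
  rw [labelGE, Finset.mem_filter, fmLabel_of_lt (by omega), hPQ]
  constructor
  · rintro ⟨-, h⟩
    split at h
    next p hp =>
      have h₁ : p.2 = d := by simpa using List.find?_some hp
      rcases List.mem_append.1 (List.mem_of_find?_eq_some hp) with h₂ | h₂
      · rw [← ht, List.mem_toFinset, ← h₁]
        exact List.mem_map_of_mem h₂
      · exact absurd h (hQ p h₂).not_ge
    next =>
      have h' : l ≤ r + 1 := h
      omega
  · intro h
    refine ⟨targets_subset _ _ _ h, ?_⟩
    rw [← ht, List.mem_toFinset, List.mem_map] at h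
    obtain ⟨p, hp, rfl⟩ := h
    rw [find?_eq_some_of_nodup hnd (List.mem_append_left _ hp)]
    exact hP p hp

theorem sum_fmPairs (hcs : cs.Pairwise (· < ·)) (hM : ∀ j, ∀ x ∈ M (j + 1), x ∈ cs)
    (hcard : ∀ j, (M (j + 2)).card ≤ (M (j + 1)).card) {r : ℕ} (hr : r + 2 ≤ L) :
    ((fmPairs L M (r + 2)).map fun p =>
      if p.2 < p.1 then fmLabel L M (r + 2) p.1 + 1 - (r + 2) else 0).sum =
    ∑ l ∈ Finset.Icc (r + 2) L, wraps cs (labelGE L M (r + 2) l) (M (r + 1)) := by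
  -- A wrapping pairing contributes `1` for each `l` from its row up to its label.
  have h₁ : ∀ P : List (ℕ × ℕ), (P.map fun p =>
      if p.2 < p.1 then fmLabel L M (r + 2) p.1 + 1 - (r + 2) else 0).sum =
      ∑ l ∈ Finset.Icc (r + 2) L,
        P.countP (fun p => p.2 < p.1 ∧ l ≤ fmLabel L M (r + 2) p.1) := by
    intro P
    induction P with
    | nil => simp
    | cons p P ih =>
      simp only [List.map_cons, List.sum_cons, ih, List.countP_cons, Finset.sum_add_distrib,
        decide_eq_true_eq]
      rw [add_comm]
      congr 1
      by_cases hp : p.2 < p.1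
      · simp only [hp, if_true, true_and]
        rw [← Finset.sum_filter, Finset.sum_const, smul_eq_mul, mul_one, ← Nat.card_Icc]
        congr 1
        have := (fmLabel_mem_Icc hr M p.1).2
        ext l
        simp only [Finset.mem_Icc, Finset.mem_filter]
        omega
      · simp [hp]
  rw [h₁]
  refine Finset.sum_congr rfl fun l hl => ?_
  rw [Finset.mem_Icc] at hl
  obtain ⟨P, Q, hPQ, -, hP, hQ, -, hw⟩ :=
    fmPairs_split hcs hM hcard hr (l := l) (by omega)
  rw [hPQ, List.countP_append, ← hw]
  have h₂ : Q.countP (fun p => p.2 < p.1 ∧ l ≤ fmLabel L M (r + 2) p.1) = 0 := by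
    rw [List.countP_eq_zero]
    intro p hp
    have := hQ p hp
    simp only [decide_eq_true_eq]
    omega
  rw [h₂, add_zero]
  refine List.countP_congr fun p hp => ?_
  simp [hP p hp]

theorem rowEnergy_labelGE (hcs : cs.Pairwise (· < ·)) (hM : ∀ j, ∀ x ∈ M (j + 1), x ∈ cs)
    (hcard : ∀ j, (M (j + 2)).card ≤ (M (j + 1)).card) {k l : ℕ} (hk : k + 1 ≤ l) (hl : l ≤ L) :
    rowEnergy cs M k (labelGE L M (k + 1) l) =
      ∑ r ∈ Finset.Icc 2 (k + 1), wraps cs (labelGE L M r l) (M (r - 1)) := by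
  induction k with
  | zero => simp [rowEnergy]
  | succ k ih =>
    rw [rowEnergy, ← labelGE_eq_targets hcs hM hcard hk hl, ih (by omega),
      Finset.sum_Icc_succ_top (by omega : 2 ≤ k + 1 + 1), add_comm]
    rfl

/-- The major index is the sum of the energies of the rows. -/
theorem maj_eq_sum_rowEnergy (hcs : cs.Pairwise (· < ·)) (hM : ∀ j, ∀ x ∈ M (j + 1), x ∈ cs)
    (hcard : ∀ j, (M (j + 2)).card ≤ (M (j + 1)).card) :
    maj L M = ∑ k ∈ Finset.range L, rowEnergy cs M k (M (k + 1)) := by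
  have h₁ : maj L M = ∑ r ∈ Finset.Icc 2 L, ∑ l ∈ Finset.Icc r L,
      wraps cs (labelGE L M r l) (M (r - 1)) := by
    refine Finset.sum_congr rfl fun r hr => ?_
    rw [Finset.mem_Icc] at hr
    obtain ⟨s, rfl⟩ := Nat.exists_eq_add_of_le' hr.1
    exact sum_fmPairs hcs hM hcard hr.2
  have h₂ : ∑ k ∈ Finset.range L, rowEnergy cs M k (M (k + 1)) =
      ∑ l ∈ Finset.Icc 1 L, ∑ r ∈ Finset.Icc 2 l, wraps cs (labelGE L M r l) (M (r - 1)) := by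
    refine Finset.sum_nbij' (· + 1) (· - 1) ?_ ?_ ?_ ?_ fun k hk => ?_
    · simp only [Finset.mem_range, Finset.mem_Icc]; omega
    · simp only [Finset.mem_range, Finset.mem_Icc]; omega
    · simp
    · simp only [Finset.mem_Icc]; omega
    · rw [Finset.mem_range] at hk
      rw [← labelGE_self (r := k + 1) hk M, rowEnergy_labelGE hcs hM hcard le_rfl hk]
  rw [h₁, h₂]
  refine Finset.sum_comm' fun r l => ?_
  simp only [Finset.mem_Icc]
  omega

end Energy

/-! ### Words and the positions of their letters -/

theorem columnWord_eq_nil {M : Rows} {x K : ℕ} (h : ∀ k, 1 ≤ k → k ≤ K → x ∉ M k) :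
    columnWord M x K = [] := by
  induction K with
  | zero => rfl
  | succ K ih =>
    rw [columnWord, if_neg (h (K + 1) (by omega) le_rfl), ih fun k h₁ h₂ => h k h₁ (by omega)]
    rfl

theorem columnWord_eq_singleton {M : Rows} {x K a : ℕ} (ha : 1 ≤ a) (haK : a ≤ K)
    (h : ∀ k, 1 ≤ k → k ≤ K → (x ∈ M k ↔ k = a)) : columnWord M x K = [a] := by
  induction K with
  | zero => omega
  | succ K ih =>
    rw [columnWord]
    by_cases hK : a = K + 1
    · rw [if_pos ((h _ (by omega) le_rfl).2 hK.symm), columnWord_eq_nil, hK]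
      · rfl
      · intro k h₁ h₂ hx
        have := (h k h₁ (by omega)).1 hx
        omega
    · rw [if_neg (fun hx => hK ((h _ (by omega) le_rfl).1 hx).symm),
        ih (by omega) fun k h₁ h₂ => h k h₁ (by omega)]
      rfl

theorem count_columnWord {M : Rows} {x K k : ℕ} (hk : 1 ≤ k) (hK : k ≤ K) :
    (columnWord M x K).count k = if x ∈ M k then 1 else 0 := by
  have h0 : ∀ J, J < k → (columnWord M x J).count k = 0 := by
    intro J hJ
    induction J with
    | zero => rfl
    | succ J ih =>
      rw [columnWord, List.count_append, ih (by omega)]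
      split_ifs
      · simp [hJ.ne]
      · rfl
  induction K, hK using Nat.le_induction with
  | base =>
    obtain ⟨j, rfl⟩ := Nat.exists_eq_add_of_le' hk
    rw [columnWord, List.count_append, h0 j (by omega)]
    split_ifs <;> simp
  | succ K hK ih =>
    rw [columnWord, List.count_append, ih]
    have : K + 1 ≠ k := by omega
    split_ifs <;> simp [this]

theorem count_arrWord {M : Rows} {cs : List ℕ} {K k : ℕ} (hcs : cs.Nodup)
    (hM : ∀ x ∈ M k, x ∈ cs) (hk : 1 ≤ k) (hK : k ≤ K) :
    (arrWord cs K M).count k = (M k).card := by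
  rw [← countP_mem_eq_card hcs hM]
  clear hM hcs
  induction cs with
  | nil => rfl
  | cons x cs ih =>
    rw [arrWord_cons, List.count_append, ih, count_columnWord hk hK, List.countP_cons, add_comm]
    simp

theorem mem_letterPositions {w : List ℕ} {a i : ℕ} : i ∈ letterPositions w a ↔ w[i]? = some a := by
  rw [letterPositions, Finset.mem_filter, Finset.mem_range, and_iff_right_iff_imp]
  intro h
  exact (List.getElem?_eq_some_iff.1 h).1

theorem mem_range_of_mem_letterPositions {w : List ℕ} {a i : ℕ} (h : i ∈ letterPositions w a) :
    i ∈ List.range w.length := by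
  rw [letterPositions, Finset.mem_filter, Finset.mem_range] at h
  exact List.mem_range.2 h.1

/-- The rows that consist of the positions of the letters of `w`, with only the positions
satisfying `p` being kept, have the corresponding subword as their column reading word. -/
theorem arrWord_letterPositions {w : List ℕ} {K : ℕ} (hw : ∀ a ∈ w, 1 ≤ a ∧ a ≤ K) (p : ℕ → Prop)
    [DecidablePred p] :
    arrWord (List.range w.length) K (fun k => (letterPositions w k).filter p) =
      (w.zipIdx.filter fun x => p x.2).map Prod.fst := by
  have h₁ : List.range w.length = w.zipIdx.map Prod.snd := by
    rw [List.zipIdx_map_snd, List.range_eq_range']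
  have h₂ : ∀ l : List (ℕ × ℕ), (∀ x ∈ l, w[x.2]? = some x.1) →
      arrWord (l.map Prod.snd) K (fun k => (letterPositions w k).filter p) =
        (l.filter fun x => p x.2).map Prod.fst := by
    intro l hl
    induction l with
    | nil => rfl
    | cons x l ih =>
      have hx := hl x (by simp)
      have hxK := hw x.1 (List.mem_of_getElem? hx)
      rw [List.map_cons, arrWord_cons, ih fun y hy => hl y (by simp [hy])]
      by_cases hp : p x.2
      · rw [List.filter_cons_of_pos (by simpa using hp), List.map_cons,
          columnWord_eq_singleton hxK.1 hxK.2]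
        · rfl
        · intro k _ _
          rw [Finset.mem_filter, mem_letterPositions, hx, Option.some_inj]
          simp only [hp, and_true]
          exact eq_comm
      · rw [List.filter_cons_of_neg (by simpa using hp), columnWord_eq_nil]
        · rfl
        · intro k _ _ h
          exact hp (Finset.mem_filter.1 h).2
  rw [h₁]
  refine h₂ _ fun x hx => ?_
  exact List.mem_zipIdx_iff_getElem?.1 hx

theorem arrWord_letterPositions_self {w : List ℕ} {K : ℕ} (hw : ∀ a ∈ w, 1 ≤ a ∧ a ≤ K) :
    arrWord (List.range w.length) K (letterPositions w) = w := by
  have h := arrWord_letterPositions hw fun _ => True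
  simpa [List.zipIdx_map_fst] using h

theorem card_letterPositions (w : List ℕ) (hw : ∀ a ∈ w, 1 ≤ a) {k : ℕ} (hk : 1 ≤ k) :
    (letterPositions w k).card = w.count k := by
  have hK : ∀ a ∈ w, 1 ≤ a ∧ a ≤ max k (w.foldr max 0) := fun a ha =>
    ⟨hw a ha, le_max_of_le_right (List.le_max_of_le' 0 ha le_rfl)⟩
  conv_rhs => rw [← arrWord_letterPositions_self hK]
  exact (count_arrWord List.nodup_range (fun x hx => mem_range_of_mem_letterPositions hx) hk
    (le_max_left _ _)).symm

/-! ### Charge as a sum of energies -/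

theorem cyclicNext_mem {S : Finset ℕ} {c d : ℕ} (h : cyclicNext S c = some d) : d ∈ S := by
  rw [cyclicNext] at h
  split_ifs at h
  · rw [Option.some_inj] at h
    rw [← h]
    exact (Finset.mem_filter.1 (Finset.min'_mem _ _)).1
  · rw [Option.some_inj] at h
    rw [← h]
    exact Finset.min'_mem _ _

theorem exists_cyclicNext {S : Finset ℕ} (h : S.Nonempty) (c : ℕ) :
    ∃ d, cyclicNext S c = some d := by
  rw [cyclicNext]
  split_ifs <;> simp

/-- The scan for the letters `m, m - 1, …, 1` finds each letter `k` at a position `pos k`. -/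
theorem exists_scan {w : List ℕ} {m : ℕ} (h : ∀ k, 1 ≤ k → k ≤ m → (letterPositions w k).Nonempty)
    (q : ℕ) : ∃ pos : ℕ → ℕ,
      (∀ k, 1 ≤ k → k ≤ m → pos k ∈ letterPositions w k) ∧
      (∀ k, 1 ≤ k → k < m → cyclicNext (letterPositions w k) (pos (k + 1)) = some (pos k)) ∧
      ∀ i, i ∈ scanPositions w q m ↔ ∃ k, 1 ≤ k ∧ k ≤ m ∧ pos k = i := by
  suffices H : ∃ pos : ℕ → ℕ,
      (∀ k, 1 ≤ k → k ≤ m → cyclicNext (letterPositions w k)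
        (if k = m then q else pos (k + 1)) = some (pos k)) ∧
      ∀ i, i ∈ scanPositions w q m ↔ ∃ k, 1 ≤ k ∧ k ≤ m ∧ pos k = i by
    obtain ⟨pos, h₁, h₂⟩ := H
    refine ⟨pos, fun k hk hm => cyclicNext_mem (h₁ k hk hm), fun k hk hm => ?_, h₂⟩
    have := h₁ k hk hm.le
    rwa [if_neg hm.ne] at this
  induction m generalizing q with
  | zero => exact ⟨id, fun k _ _ => by omega, fun i => by
      simp only [scanPositions, List.not_mem_nil, false_iff]
      omega⟩
  | succ m ih =>
    obtain ⟨p, hp⟩ := exists_cyclicNext (h (m + 1) (by omega) le_rfl) q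
    obtain ⟨pos, h₁, h₂⟩ := ih (fun k h₁ h₂ => h k h₁ (by omega)) p
    refine ⟨Function.update pos (m + 1) p, fun k hk hm => ?_, fun i => ?_⟩
    · rcases hm.eq_or_lt with rfl | hm
      · rw [if_pos rfl, Function.update_self, hp]
      · rw [if_neg hm.ne, Function.update_of_ne hm.ne, ← h₁ k hk (by omega)]
        congr 1
        split_ifs with hkm
        · subst hkm
          rw [Function.update_self]
        · rw [Function.update_of_ne (by omega)]
    · simp only [scanPositions, hp, List.mem_cons, h₂]
      constructor
      · rintro (rfl | ⟨k, hk, hm, rfl⟩)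
        · exact ⟨m + 1, by omega, le_rfl, Function.update_self _ _ _⟩
        · exact ⟨k, hk, by omega, Function.update_of_ne (by omega) _ _⟩
      · rintro ⟨k, hk, hm, rfl⟩
        rcases hm.eq_or_lt with rfl | hm
        · left
          exact Function.update_self _ _ _
        · right
          exact ⟨k, hk, by omega, (Function.update_of_ne hm.ne _ _).symm⟩

/-- The energy loses the number of wrappings of a path when the path is removed. -/
theorem rowEnergy_eq_add_erase {cs : List ℕ} {M : Rows} (hcs : cs.Pairwise (· < ·))
    (hM : ∀ j, ∀ x ∈ M (j + 1), x ∈ cs) (hcard : ∀ j, (M (j + 2)).card ≤ (M (j + 1)).card)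
    {pos : ℕ → ℕ} {k : ℕ}
    (hpos : ∀ j, 1 ≤ j → j ≤ k → cyclicNext (M j) (pos (j + 1)) = some (pos j))
    {A : Finset ℕ} (hA : ∀ x ∈ A, x ∈ cs) (hAc : 0 < k → A.card ≤ (M k).card)
    (hpA : pos (k + 1) ∈ A) :
    rowEnergy cs M k A = (∑ i ∈ Finset.Icc 1 k, if pos i < pos (i + 1) then 1 else 0) +
      rowEnergy cs (fun j => (M j).erase (pos j)) k (A.erase (pos (k + 1))) := by
  induction k generalizing A with
  | zero => rfl
  | succ k ih =>
    have hAc := hAc k.succ_pos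
    obtain ⟨d, -, hd, ht, hw⟩ := targets_eq_insert hcs hA (hM k) hAc hpA
    obtain rfl : pos (k + 1) = d := by
      have := hpos (k + 1) (by omega) le_rfl
      rwa [hd, Option.some_inj, eq_comm] at this
    have hnot : pos (k + 1) ∉ targets cs (A.erase (pos (k + 1 + 1)))
        ((M (k + 1)).erase (pos (k + 1))) := fun h =>
      Finset.notMem_erase _ _ (targets_subset _ _ _ h)
    have hih := ih (A := targets cs A (M (k + 1))) (fun j h₁ h₂ => hpos j h₁ (by omega))
      (fun x hx => hM k x (targets_subset _ _ _ hx))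
      (fun hk => by
        obtain ⟨j, rfl⟩ := Nat.exists_eq_add_of_le' hk
        exact (Finset.card_le_card (targets_subset _ _ _)).trans (hcard j))
      (by rw [ht]; exact Finset.mem_insert_self _ _)
    rw [rowEnergy, rowEnergy, hih, hw, ht, Finset.erase_insert hnot,
      Finset.sum_Icc_succ_top (by omega)]
    omega

theorem idxOf_map_fst_lt_iff {z : List (ℕ × ℕ)} (hz : z.Pairwise fun x y => x.2 < y.2)
    (hnd : (z.map Prod.fst).Nodup) {x y : ℕ × ℕ} (hx : x ∈ z) (hy : y ∈ z) :
    (z.map Prod.fst).idxOf x.1 < (z.map Prod.fst).idxOf y.1 ↔ x.2 < y.2 := by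
  induction z with
  | nil => simp at hx
  | cons t z ih =>
    rw [List.map_cons, List.nodup_cons] at hnd
    rw [List.pairwise_cons] at hz
    have hne : ∀ s ∈ z, t.1 ≠ s.1 := fun s hs he => hnd.1 (he ▸ List.mem_map_of_mem hs)
    rw [List.map_cons]
    rcases List.mem_cons.1 hx with rfl | hx' <;> rcases List.mem_cons.1 hy with rfl | hy'
    · simp
    · rw [List.idxOf_cons_self, List.idxOf_cons_ne _ (hne y hy')]
      simp [hz.1 y hy']
    · rw [List.idxOf_cons_self]
      simp [(hz.1 x hx').le]
    · rw [List.idxOf_cons_ne _ (hne y hy'), List.idxOf_cons_ne _ (hne x hx'),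
        Nat.succ_lt_succ_iff]
      exact ih hz.2 hnd.2 hx' hy'

theorem pairwise_snd_zipIdx (w : List ℕ) : w.zipIdx.Pairwise fun x y => x.2 < y.2 := by
  rw [← List.pairwise_map (f := Prod.snd) (R := (· < ·)), List.zipIdx_map_snd]
  exact List.pairwise_lt_range'

/-- The charge of the first charge subword, in terms of the positions of its letters. -/
theorem chargePerm_chargeSubword {w : List ℕ} {m : ℕ} {pos : ℕ → ℕ}
    (hpos : ∀ k, 1 ≤ k → k ≤ m → pos k ∈ letterPositions w k)
    (hmem : ∀ i, i ∈ chargePositions w ↔ ∃ k, 1 ≤ k ∧ k ≤ m ∧ pos k = i) :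
    chargePerm (chargeSubword w) =
      ∑ i ∈ Finset.Icc 1 (m - 1), if pos i < pos (i + 1) then m - i else 0 := by
  rw [chargeSubword]
  set z := w.zipIdx.filter fun x => x.2 ∈ chargePositions w with hz
  have hzmem : ∀ x, x ∈ z ↔ ∃ k, 1 ≤ k ∧ k ≤ m ∧ x = (k, pos k) := by
    intro x
    simp only [hz, List.mem_filter, List.mem_zipIdx_iff_getElem?, hmem, decide_eq_true_eq]
    constructor
    · rintro ⟨hx, k, hk, hm, hkx⟩
      have := mem_letterPositions.1 (hpos k hk hm)
      rw [hkx, hx, Option.some_inj] at this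
      exact ⟨k, hk, hm, Prod.ext this hkx.symm⟩
    · rintro ⟨k, hk, hm, rfl⟩
      exact ⟨mem_letterPositions.1 (hpos k hk hm), k, hk, hm, rfl⟩
  have hzp : z.Pairwise fun x y => x.2 < y.2 := (pairwise_snd_zipIdx w).filter _
  have hnd : (z.map Prod.fst).Nodup := by
    rw [List.Nodup, List.pairwise_map]
    refine hzp.imp_of_mem fun {x y} hx hy hxy he => ?_
    obtain ⟨k, _, _, rfl⟩ := (hzmem x).1 hx
    obtain ⟨l, _, _, rfl⟩ := (hzmem y).1 hy
    simp only at he hxy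
    rw [he] at hxy
    exact lt_irrefl _ hxy
  have hlen : (z.map Prod.fst).length = m := by
    have : (z.map Prod.fst).toFinset = Finset.Icc 1 m := by
      ext k
      simp only [List.mem_toFinset, List.mem_map, hzmem, Finset.mem_Icc]
      constructor
      · rintro ⟨_, ⟨l, h₁, h₂, rfl⟩, rfl⟩
        exact ⟨h₁, h₂⟩
      · rintro ⟨h₁, h₂⟩
        exact ⟨_, ⟨k, h₁, h₂, rfl⟩, rfl⟩
    rw [← List.toFinset_card_of_nodup hnd, this]
    simp
  rw [chargePerm, hlen]
  refine Finset.sum_congr rfl fun i hi => ?_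
  rw [Finset.mem_Icc] at hi
  have := idxOf_map_fst_lt_iff hzp hnd ((hzmem (i, pos i)).2 ⟨i, hi.1, by omega, rfl⟩)
    ((hzmem (i + 1, pos (i + 1))).2 ⟨i + 1, by omega, by omega, rfl⟩)
  simp only at this
  simp only [this]

theorem energy_nil (k : ℕ) : energy k [] = 0 := by
  induction k with
  | zero => rfl
  | succ k ih => simpa [energy, queueLength, keepServing] using ih

theorem rowEnergy_empty (cs : List ℕ) (M : Rows) (k : ℕ) : rowEnergy cs M k ∅ = 0 := by
  induction k with
  | zero => rfl
  | succ k ih => rw [rowEnergy, wraps_empty, targets_empty, ih]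

theorem foldr_max_mem {w : List ℕ} (hw : w ≠ []) : w.foldr max 0 ∈ w := by
  induction w with
  | nil => exact absurd rfl hw
  | cons a w ih =>
    rw [List.foldr_cons]
    rcases eq_or_ne w [] with rfl | h
    · simp
    · rcases max_choice a (w.foldr max 0) with h' | h'
      · rw [h']; simp
      · rw [h']; exact List.mem_cons_of_mem _ (ih h)

/-- Extraction of the first charge subword from a nonempty word with partition content. -/
theorem charge_step {w : List ℕ} {L : ℕ} (hne : w ≠ []) (hw : ∀ a ∈ w, 1 ≤ a ∧ a ≤ L)
    (hcount : ∀ k, w.count (k + 2) ≤ w.count (k + 1)) :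
    (∑ k ∈ Finset.range L, energy k w = chargePerm (chargeSubword w) +
      ∑ k ∈ Finset.range L, energy k (chargeRest w)) ∧
    (∀ a ∈ chargeRest w, 1 ≤ a ∧ a ≤ L) ∧
    (∀ k, (chargeRest w).count (k + 2) ≤ (chargeRest w).count (k + 1)) ∧
    (chargeRest w).count 1 + 1 = w.count 1 := by
  set m := w.foldr max 0 with hm
  have hmw : m ∈ w := foldr_max_mem hne
  have hmL := (hw m hmw).2
  have hm1 := (hw m hmw).1
  have hle : ∀ a ∈ w, a ≤ m := fun a ha => List.le_max_of_le' 0 ha le_rfl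
  have hcard : ∀ j, (letterPositions w (j + 1)).card = w.count (j + 1) := fun j =>
    card_letterPositions w (fun a ha => (hw a ha).1) (by omega)
  have hcardle : ∀ j, (letterPositions w (j + 2)).card ≤ (letterPositions w (j + 1)).card :=
    fun j => (hcard (j + 1)).le.trans ((hcount j).trans (hcard j).ge)
  have hcount0 : ∀ k, m < k → w.count k = 0 := fun k hk => by
    rw [List.count_eq_zero]
    exact fun h => (hle k h).not_gt hk
  have hcount1 : ∀ k, 1 ≤ k → k ≤ m → 0 < w.count k := by
    intro k h1 hk
    induction hk using Nat.decreasingInduction with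
    | of_succ k hk ih =>
      obtain ⟨j, rfl⟩ := Nat.exists_eq_add_of_le' h1
      exact (ih (by omega)).trans_le (hcount j)
    | self => exact List.count_pos_iff.2 hmw
  have hcs : (List.range w.length).Pairwise (· < ·) := List.pairwise_lt_range
  have hM : ∀ j, ∀ x ∈ letterPositions w (j + 1), x ∈ List.range w.length :=
    fun j x hx => mem_range_of_mem_letterPositions hx
  obtain ⟨pos, hpos, hnext, hmem⟩ := exists_scan (w := w) (m := m) (fun k h1 hk => by
    obtain ⟨j, rfl⟩ := Nat.exists_eq_add_of_le' h1
    rw [← Finset.card_pos, hcard]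
    exact hcount1 _ h1 hk) 0
  change ∀ i, i ∈ chargePositions w ↔ _ at hmem
  set M' : Rows := fun k => (letterPositions w k).filter fun i => i ∉ chargePositions w with hM'
  have hrest : arrWord (List.range w.length) L M' = chargeRest w :=
    arrWord_letterPositions hw fun i => i ∉ chargePositions w
  have hM'e : ∀ j, 1 ≤ j → j ≤ m → M' j = (letterPositions w j).erase (pos j) := by
    intro j h1 hj
    ext i
    rw [hM', Finset.mem_filter, Finset.mem_erase, hmem, and_comm, and_congr_left_iff]
    intro hi
    rw [not_iff_not]
    constructor
    · rintro ⟨k, hk, hkm, rfl⟩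
      have := mem_letterPositions.1 (hpos k hk hkm)
      rw [mem_letterPositions.1 hi, Option.some_inj] at this
      rw [this]
    · rintro rfl
      exact ⟨j, h1, hj, rfl⟩
  have hM'0 : ∀ j, 1 ≤ j → m < j → letterPositions w j = ∅ := by
    intro j h1 hj
    obtain ⟨j, rfl⟩ := Nat.exists_eq_add_of_le' h1
    rw [← Finset.card_eq_zero, hcard, hcount0 _ hj]
  have hcountrest : ∀ k, 1 ≤ k → (chargeRest w).count k = w.count k - 1 := by
    intro k h1
    have hsub : ∀ x ∈ M' k, x ∈ List.range w.length := fun x hx =>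
      mem_range_of_mem_letterPositions (Finset.mem_filter.1 hx).1
    rcases le_or_gt k m with hk | hk
    · rw [← hrest, count_arrWord List.nodup_range hsub h1 (hk.trans hmL), hM'e k h1 hk,
        Finset.card_erase_of_mem (hpos k h1 hk)]
      obtain ⟨j, rfl⟩ := Nat.exists_eq_add_of_le' h1
      rw [hcard]
    · have h0 := hcount0 k hk
      rw [h0]
      rw [List.count_eq_zero] at h0 ⊢
      intro h
      simp only [chargeRest, List.mem_map, List.mem_filter, List.mem_zipIdx_iff_getElem?] at h
      obtain ⟨x, ⟨hx, -⟩, rfl⟩ := h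
      exact h0 (List.mem_of_getElem? hx)
  refine ⟨?_, ?_, ?_, ?_⟩
  · rw [chargePerm_chargeSubword hpos hmem]
    have henergy : ∀ k ∈ Finset.range L, energy k w =
        (if k < m then ∑ i ∈ Finset.Icc 1 k, if pos i < pos (i + 1) then 1 else 0 else 0) +
          energy k (chargeRest w) := by
      intro k hk
      rw [Finset.mem_range] at hk
      rw [← hrest, energy_arrWord hk _ List.nodup_range]
      conv_lhs => rw [← arrWord_letterPositions_self hw]
      rw [energy_arrWord hk _ List.nodup_range]
      split_ifs with hkm
      · rw [rowEnergy_eq_add_erase (pos := pos) hcs hM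
          hcardle
          (fun j h1 hj => hnext j h1 (by omega)) (hM k)
          (fun h0 => by
            obtain ⟨j, rfl⟩ := Nat.exists_eq_add_of_le' h0
            exact hcardle j) (hpos (k + 1) (by omega) hkm),
          ← hM'e (k + 1) (by omega) hkm,
          rowEnergy_congr (M := M') fun j h1 hj => hM'e j h1 (by omega)]
      · have h0 := hM'0 (k + 1) (by omega) (by omega)
        have h0' : M' (k + 1) = ∅ := by simp only [hM', h0, Finset.filter_empty]
        rw [h0, h0', rowEnergy_empty, rowEnergy_empty]
    rw [Finset.sum_congr rfl henergy, Finset.sum_add_distrib, ← Finset.sum_filter]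
    congr 1
    rw [Finset.sum_comm' (t' := Finset.Icc 1 (m - 1)) (s' := fun i => Finset.Ico i m)]
    · refine Finset.sum_congr rfl fun i _ => ?_
      rw [Finset.sum_const, Nat.card_Ico, smul_eq_mul, mul_ite, mul_one, mul_zero]
    · intro k i
      simp only [Finset.mem_filter, Finset.mem_range, Finset.mem_Icc, Finset.mem_Ico]
      omega
  · intro a ha
    simp only [chargeRest, List.mem_map, List.mem_filter, List.mem_zipIdx_iff_getElem?] at ha
    obtain ⟨x, ⟨hx, -⟩, rfl⟩ := ha
    exact hw _ (List.mem_of_getElem? hx)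
  · intro k
    rw [hcountrest _ (by omega), hcountrest _ (by omega)]
    exact Nat.sub_le_sub_right (hcount k) 1
  · rw [hcountrest 1 le_rfl]
    exact Nat.sub_add_cancel (hcount1 1 le_rfl hm1)

/-- The charge of a word with partition content is the sum of its energies. -/
theorem charge_eq_sum_energy {w : List ℕ} {L : ℕ} (hw : ∀ a ∈ w, 1 ≤ a ∧ a ≤ L)
    (hcount : ∀ k, w.count (k + 2) ≤ w.count (k + 1)) :
    charge w = ∑ k ∈ Finset.range L, energy k w := by
  induction hN : w.count 1 generalizing w with
  | zero =>
    have h0 : ∀ k, w.count (k + 1) = 0 := fun k => by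
      induction k with
      | zero => exact hN
      | succ k ih => exact Nat.le_zero.1 (ih ▸ hcount k)
    have : w = [] := by
      by_contra hne
      obtain ⟨a, ha⟩ := List.exists_mem_of_ne_nil w hne
      obtain ⟨j, rfl⟩ := Nat.exists_eq_add_of_le' (hw a ha).1
      exact List.count_eq_zero.1 (h0 j) ha
    subst this
    simp [charge, energy_nil]
  | succ N ih =>
    have hne : w ≠ [] := by
      rintro rfl
      simp at hN
    obtain ⟨h₁, h₂, h₃, h₄⟩ := charge_step hne hw hcount
    have hN' : (chargeRest w).count 1 = N := by omega
    rw [h₁, ← ih h₂ h₃ hN', charge, charge, hN, hN', Finset.sum_range_succ', add_comm]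
    simp only [Function.iterate_succ_apply, Function.iterate_zero, id]

/-! ### The collapse of an arrangement and of its column reading word -/

/-- The number of balls of `D` that are not matched with a ball of `U`. -/
def spareBalls (U D : Finset ℕ) : List ℕ → ℕ
  | [] => 0
  | x :: u => spareBalls U D u + (if x ∈ D then 1 else 0) - if x ∈ U then 1 else 0

/-- The columns of the balls of `U` that are not matched with a ball of `D`. -/
def unmatched (U D : Finset ℕ) : List ℕ → List ℕ
  | [] => []
  | x :: u =>
    if x ∈ U ∧ spareBalls U D u + (if x ∈ D then 1 else 0) = 0 then x :: unmatched U D u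
    else unmatched U D u

theorem foldl_eq_unmatched (U D : Finset ℕ) (cs st : List ℕ) :
    cs.foldl (fun st c =>
      let st' := if c ∈ U then c :: st else st
      if c ∈ D then st'.tail else st') st =
      (unmatched U D cs).reverse ++ st.drop (spareBalls U D cs) := by
  induction cs generalizing st with
  | nil => rfl
  | cons x u ih =>
    rw [List.foldl_cons, ih]
    by_cases hU : x ∈ U <;> by_cases hD : x ∈ D <;>
      simp only [unmatched, spareBalls, hU, hD, if_true, if_false, true_and, false_and,
        Nat.succ_ne_zero, add_zero, Nat.sub_zero, Nat.add_sub_cancel, List.tail_cons]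
    · rcases Nat.eq_zero_or_pos (spareBalls U D u) with h | h
      · simp [h]
      · obtain ⟨s, hs⟩ := Nat.exists_eq_add_of_le' h
        simp [hs]
    · rw [← List.drop_one, List.drop_drop, add_comm]

theorem mem_of_mem_unmatched {U D : Finset ℕ} {x : ℕ} {cs : List ℕ} (h : x ∈ unmatched U D cs) :
    x ∈ U ∧ x ∈ cs := by
  induction cs with
  | nil => simp [unmatched] at h
  | cons y u ih =>
    rw [unmatched] at h
    by_cases hy : y ∈ U ∧ spareBalls U D u + (if y ∈ D then 1 else 0) = 0
    · rw [if_pos hy] at h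
      rcases List.mem_cons.1 h with rfl | h
      · exact ⟨hy.1, by simp⟩
      · exact ⟨(ih h).1, by simp [(ih h).2]⟩
    · rw [if_neg hy] at h
      exact ⟨(ih h).1, by simp [(ih h).2]⟩

/-- The operator `e_i^⋆` on an arrangement, with the unmatched balls computed from right to left. -/
def lowerRow (cs : List ℕ) (i : ℕ) (M : Rows) : Rows := fun k =>
  if k = i + 1 then M (i + 1) \ (unmatched (M (i + 1)) (M i) cs).toFinset
  else if k = i then M i ∪ (unmatched (M (i + 1)) (M i) cs).toFinset else M k

theorem dropStar_eq_lowerRow (n i : ℕ) (M : Rows) :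
    dropStar n i M = lowerRow (List.range' 1 n) i M := by
  have h : (unmatchedStack n (M (i + 1)) (M i)).toFinset =
      (unmatched (M (i + 1)) (M i) (List.range' 1 n)).toFinset := by
    rw [unmatchedStack, foldl_eq_unmatched]
    simp
  funext k
  simp only [dropStar, h, lowerRow, Function.update_apply]
  split_ifs <;> first | rfl | omega

theorem spare_columnWord_of_lt {M : Rows} {x i K : ℕ} (h : K < i) (d : ℕ) :
    spare i d (columnWord M x K) = d := by
  induction K with
  | zero => rfl
  | succ K ih =>
    have h₁ : K + 1 ≠ i + 1 := by omega
    rw [columnWord]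
    split_ifs
    · simp only [List.singleton_append, spare, h.ne, h₁, if_false]
      exact ih (by omega)
    · exact ih (by omega)

theorem lower_columnWord_of_lt {M : Rows} {x i K : ℕ} (h : K < i) (d : ℕ) :
    lower i d (columnWord M x K) = columnWord M x K := by
  induction K with
  | zero => rfl
  | succ K ih =>
    have h₁ : K + 1 ≠ i + 1 := by omega
    rw [columnWord]
    split_ifs
    · simp only [List.singleton_append, lower, h₁, false_and, if_false]
      rw [ih (by omega)]
    · exact ih (by omega)

theorem spare_columnWord {M : Rows} {x i K : ℕ} (hK : i + 2 ≤ K) (d : ℕ) :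
    spare (i + 1) d (columnWord M x K) =
      d + (if x ∈ M (i + 1) then 1 else 0) - if x ∈ M (i + 2) then 1 else 0 := by
  induction K, hK using Nat.le_induction with
  | base =>
    have h₁ := spare_columnWord_of_lt (M := M) (x := x) (Nat.lt_succ_self i) d
    simp only [Nat.succ_eq_add_one] at h₁
    simp only [columnWord]
    by_cases h₂ : x ∈ M (i + 2) <;> by_cases h₃ : x ∈ M (i + 1) <;>
      simp [h₂, h₃, spare, h₁]
  | succ K hK ih =>
    have h₁ : K + 1 ≠ i + 1 := by omega
    have h₂ : K + 1 ≠ i + 1 + 1 := by omega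
    rw [columnWord]
    by_cases hx : x ∈ M (K + 1)
    · rw [if_pos hx, List.singleton_append, spare, if_neg h₁, if_neg h₂, ih]
    · rw [if_neg hx, List.nil_append, ih]

theorem lower_columnWord {M M' : Rows} {x i K d : ℕ} (hK : i + 2 ≤ K)
    (h₁ : x ∈ M' (i + 2) ↔ x ∈ M (i + 2) ∧
      ¬(x ∈ M (i + 2) ∧ d + (if x ∈ M (i + 1) then 1 else 0) = 0))
    (h₂ : x ∈ M' (i + 1) ↔ x ∈ M (i + 1) ∨
      (x ∈ M (i + 2) ∧ d + (if x ∈ M (i + 1) then 1 else 0) = 0))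
    (h₃ : ∀ k, k ≠ i + 1 → k ≠ i + 2 → (x ∈ M' k ↔ x ∈ M k)) :
    lower (i + 1) d (columnWord M x K) = columnWord M' x K := by
  induction K, hK using Nat.le_induction with
  | base =>
    have h₄ := lower_columnWord_of_lt (M := M) (x := x) (Nat.lt_succ_self i) d
    have h₅ := spare_columnWord_of_lt (M := M) (x := x) (Nat.lt_succ_self i) d
    have h₆ : columnWord M x i = columnWord M' x i :=
      columnWord_congr fun k _ _ => (h₃ k (by omega) (by omega)).symm
    simp only [Nat.succ_eq_add_one] at h₄ h₅
    simp only [columnWord, h₁, h₂, ← h₆]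
    by_cases h₇ : x ∈ M (i + 2) <;> by_cases h₈ : x ∈ M (i + 1) <;>
      simp only [h₇, h₈, if_true, if_false, List.cons_append, List.nil_append, lower, spare, h₄,
        h₅, add_zero, Nat.succ_ne_zero, and_false, not_false_eq_true, true_and, false_and,
        or_false, false_or, and_true, (Nat.succ_ne_self _).symm]
    split_ifs with h
    · rfl
    · rfl
  | succ K hK ih =>
    have h₄ : K + 1 ≠ i + 1 + 1 := by omega
    simp only [columnWord, h₃ (K + 1) (by omega) h₄]
    by_cases hx : x ∈ M (K + 1)
    · rw [if_pos hx, List.singleton_append, lower, if_neg (fun h => h₄ h.1), ih,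
        List.singleton_append]
    · rw [if_neg hx, List.nil_append, ih, List.nil_append]

theorem spare_arrWord {i K : ℕ} (hK : i + 2 ≤ K) (M : Rows) (cs : List ℕ) :
    spare (i + 1) 0 (arrWord cs K M) = spareBalls (M (i + 2)) (M (i + 1)) cs := by
  induction cs with
  | nil => rfl
  | cons x cs ih => rw [arrWord_cons, spare_append, ih, spare_columnWord hK, spareBalls]

theorem lower_arrWord {i K : ℕ} (hK : i + 2 ≤ K) (M : Rows) {cs : List ℕ} (hcs : cs.Nodup) :
    lower (i + 1) 0 (arrWord cs K M) = arrWord cs K (lowerRow cs (i + 1) M) := by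
  induction cs with
  | nil => rfl
  | cons x cs ih =>
    rw [List.nodup_cons] at hcs
    rw [arrWord_cons, lower_append, ih hcs.2, spare_arrWord hK, arrWord_cons]
    have hx : x ∈ unmatched (M (i + 2)) (M (i + 1)) (x :: cs) ↔ x ∈ M (i + 2) ∧
        spareBalls (M (i + 2)) (M (i + 1)) cs + (if x ∈ M (i + 1) then 1 else 0) = 0 := by
      rw [unmatched]
      by_cases h : x ∈ M (i + 2) ∧
          spareBalls (M (i + 2)) (M (i + 1)) cs + (if x ∈ M (i + 1) then 1 else 0) = 0
      · rw [if_pos h]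
        simp [h]
      · rw [if_neg h]
        exact iff_of_false (fun hm => hcs.1 (mem_of_mem_unmatched hm).2) h
    congr 1
    · refine lower_columnWord hK ?_ ?_ fun k h₁ h₂ => ?_
      · rw [lowerRow, if_pos rfl, Finset.mem_sdiff, List.mem_toFinset, hx]
      · rw [lowerRow, if_neg (by omega), if_pos rfl, Finset.mem_union, List.mem_toFinset, hx]
      · rw [lowerRow, if_neg h₂, if_neg h₁]
    · refine arrWord_congr fun y hy k _ _ => ?_
      have hyx : y ≠ x := ne_of_mem_of_not_mem hy hcs.1
      have hu : y ∈ unmatched (M (i + 2)) (M (i + 1)) (x :: cs) ↔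
          y ∈ unmatched (M (i + 2)) (M (i + 1)) cs := by
        rw [unmatched]
        split_ifs <;> simp [hyx]
      simp only [lowerRow]
      split_ifs
      · rw [Finset.mem_sdiff, Finset.mem_sdiff, List.mem_toFinset, List.mem_toFinset, hu]
      · rw [Finset.mem_union, Finset.mem_union, List.mem_toFinset, List.mem_toFinset, hu]
      · rfl

theorem lowerRange_arrWord {n k K : ℕ} (hK : k + 1 ≤ K) (M : Rows) :
    lowerRange k (arrWord (List.range' 1 n) K M) =
      arrWord (List.range' 1 n) K (dropRange n k M) := by
  induction k generalizing M with
  | zero => rfl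
  | succ k ih =>
    rw [lowerRange, lower_arrWord hK M List.nodup_range', ← dropStar_eq_lowerRow, ih (by omega),
      dropRange]

theorem dropStar_apply_of_gt {n i k : ℕ} (h : i + 1 < k) (M : Rows) : dropStar n i M k = M k := by
  rw [dropStar_eq_lowerRow, lowerRow, if_neg (by omega), if_neg (by omega)]

theorem dropRange_apply_of_gt {n i k : ℕ} (h : i + 1 < k) (M : Rows) :
    dropRange n i M k = M k := by
  induction i generalizing M with
  | zero => rfl
  | succ i ih => rw [dropRange, ih (by omega), dropStar_apply_of_gt h]

theorem dropRange_congr {n i : ℕ} {M M' : Rows} (h : ∀ k ≤ i + 1, M k = M' k) :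
    ∀ k ≤ i + 1, dropRange n i M k = dropRange n i M' k := by
  induction i generalizing M M' with
  | zero => exact h
  | succ i ih =>
    have hd : ∀ k ≤ i + 2, dropStar n (i + 1) M k = dropStar n (i + 1) M' k := by
      intro k hk
      simp only [dropStar_eq_lowerRow, lowerRow, h (i + 1 + 1) le_rfl, h (i + 1) (by omega), h k hk]
    intro k hk
    rw [dropRange, dropRange]
    rcases hk.lt_or_eq with hk' | rfl
    · exact ih (fun k hk => hd k (by omega)) k (by omega)
    · rw [dropRange_apply_of_gt (by omega), dropRange_apply_of_gt (by omega), hd _ le_rfl]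

theorem collapse_apply_of_gt {n r k : ℕ} (h : r < k) (M : Rows) : collapse n M r k = ∅ := by
  induction r with
  | zero => rfl
  | succ r ih =>
    rw [collapse, dropRange_apply_of_gt h, Function.update_of_ne h.ne', ih (by omega)]

theorem mem_of_mem_dropRange {n i : ℕ} {M : Rows} {S : Finset ℕ} (h : ∀ k, 1 ≤ k → M k ⊆ S) :
    ∀ k, 1 ≤ k → dropRange n i M k ⊆ S := by
  induction i generalizing M with
  | zero => exact h
  | succ i ih =>
    rw [dropRange]
    refine ih fun k hk => ?_
    rw [dropStar_eq_lowerRow, lowerRow]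
    split_ifs
    · exact Finset.sdiff_subset.trans (h _ (by omega))
    · refine Finset.union_subset (h _ (by omega)) fun x hx => ?_
      exact h _ (by omega) (mem_of_mem_unmatched (List.mem_toFinset.1 hx)).1
    · exact h k hk

theorem collapse_subset {n r : ℕ} {M : Rows} {S : Finset ℕ} (h : ∀ k, 1 ≤ k → M k ⊆ S) :
    ∀ k, 1 ≤ k → collapse n M r k ⊆ S := by
  induction r with
  | zero => exact fun k _ => Finset.empty_subset S
  | succ r ih =>
    refine mem_of_mem_dropRange fun k hk => ?_
    by_cases hkr : k = r + 1
    · subst hkr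
      rw [Function.update_self]
      exact h _ hk
    · rw [Function.update_of_ne hkr]
      exact ih k hk

/-- The collapse of the letters `1, …, r` of the column reading word: the rows above row `r` still
have their original balls. -/
theorem collapseWord_arrWord {n K r : ℕ} (hr : r ≤ K) (M : Rows) :
    collapseWord r (arrWord (List.range' 1 n) K M) =
      arrWord (List.range' 1 n) K (fun k => if k ≤ r then collapse n M r k else M k) := by
  induction r with
  | zero =>
    refine arrWord_congr fun x _ k hk _ => ?_
    rw [if_neg (by omega)]
  | succ r ih =>
    rw [collapseWord, ih (by omega), lowerRange_arrWord hr]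
    refine arrWord_congr fun x _ k _ _ => ?_
    split_ifs with hk
    · rw [collapse, dropRange_congr (M' := Function.update (collapse n M r) (r + 1) (M (r + 1)))
        (fun j hj => ?_) k hk]
      rcases hj.lt_or_eq with hj' | rfl
      · rw [if_pos (by omega), Function.update_of_ne hj'.ne]
      · rw [if_neg (by omega), Function.update_self]
    · rw [dropRange_apply_of_gt (by omega), if_neg (by omega)]

/-- The row sizes of the collapse of the bottom `r` rows are letter multiplicities. -/
theorem card_collapse {n K r j : ℕ} {M : Rows} (hM : ∀ k, 1 ≤ k → M k ⊆ Finset.Icc 1 n)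
    (hr : r ≤ K) (hj : 1 ≤ j) (hjr : j ≤ r) :
    (collapse n M r j).card = (collapseWord r (arrWord (List.range' 1 n) K M)).count j := by
  rw [collapseWord_arrWord hr, count_arrWord List.nodup_range' ?_ hj (hjr.trans hr), if_pos hjr]
  intro x hx
  simp only [if_pos hjr] at hx
  have := Finset.mem_Icc.1 (collapse_subset hM j hj hx)
  rw [List.mem_range'_1]
  omega

/-! ### Semistandard tableaux from lists of rows -/

theorem Above.length_le {R U : List ℕ} (h : Above R U) : U.length ≤ R.length := by
  induction R generalizing U with
  | nil =>
    cases U with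
    | nil => simp
    | cons b U => exact h.elim
  | cons a R ih =>
    cases U with
    | nil => simp
    | cons b U => simpa using ih h.2

theorem Above.getD_lt {R U : List ℕ} (h : Above R U) {j : ℕ} (hj : j < U.length) :
    R.getD j 0 < U.getD j 0 := by
  induction R generalizing U j with
  | nil =>
    cases U with
    | nil => simp at hj
    | cons b U => exact h.elim
  | cons a R ih =>
    cases U with
    | nil => simp at hj
    | cons b U =>
      cases j with
      | zero => simpa using h.1
      | succ j => simpa using ih h.2 (by simpa using hj)

section Tableau

variable {t : List (List ℕ)}

theorem IsTableau.pairwise_getD (ht : IsTableau t) (i : ℕ) : (t.getD i []).Pairwise (· ≤ ·) := by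
  induction t generalizing i with
  | nil => simp
  | cons R t ih =>
    cases i with
    | zero => simpa using ht.2.1
    | succ i => simpa using ih ht.2.2.2 i

theorem IsTableau.above_getD (ht : IsTableau t) (i : ℕ) :
    Above (t.getD i []) (t.getD (i + 1) []) := by
  induction t generalizing i with
  | nil => exact above_nil _
  | cons R t ih =>
    cases i with
    | zero =>
      have := ht.2.2.1
      cases t <;> simpa using this
    | succ i => simpa using ih ht.2.2.2 i

theorem IsTableau.length_pos_iff (ht : IsTableau t) (i : ℕ) :
    0 < (t.getD i []).length ↔ i < t.length := by
  induction t generalizing i with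
  | nil => simp
  | cons R t ih =>
    cases i with
    | zero => simpa [List.length_pos_iff] using ht.1
    | succ i => simpa using ih ht.2.2.2 i

theorem IsTableau.length_anti (ht : IsTableau t) :
    Antitone fun i => (t.getD i []).length :=
  antitone_nat_of_succ_le fun i => (ht.above_getD i).length_le

theorem IsTableau.le_of_mem_getD (ht : IsTableau t) {j : ℕ} (hj : ∀ e ∈ t.headD [], j ≤ e)
    (i : ℕ) : ∀ e ∈ t.getD i [], j + i ≤ e := by
  induction i with
  | zero =>
    cases t with
    | nil => simp
    | cons R t => simpa using hj
  | succ i ih => exact (ht.above_getD i).succ_le ih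

/-- The shape of a tableau given by its rows. -/
def IsTableau.shape (ht : IsTableau t) : YoungDiagram where
  cells := (Finset.range t.length ×ˢ Finset.range (t.getD 0 []).length).filter
    fun c => c.2 < (t.getD c.1 []).length
  isLowerSet := by
    rintro ⟨i₂, j₂⟩ ⟨i₁, j₁⟩ ⟨hi : i₁ ≤ i₂, hj : j₁ ≤ j₂⟩ hc
    simp only [Finset.coe_filter, Finset.mem_product, Finset.mem_range, Set.mem_ofPred_eq] at hc ⊢
    have := ht.length_anti hi
    simp only at this
    omega

theorem IsTableau.mem_shape (ht : IsTableau t) {i j : ℕ} :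
    (i, j) ∈ ht.shape ↔ j < (t.getD i []).length := by
  rw [← YoungDiagram.mem_cells, IsTableau.shape]
  simp only [Finset.mem_filter, Finset.mem_product, Finset.mem_range, and_iff_right_iff_imp]
  intro h
  exact ⟨(ht.length_pos_iff i).1 (by omega), h.trans_le (ht.length_anti (Nat.zero_le i))⟩

theorem IsTableau.rowLen_shape (ht : IsTableau t) (i : ℕ) :
    ht.shape.rowLen i = (t.getD i []).length :=
  eq_of_forall_lt_iff fun j => by rw [← YoungDiagram.mem_iff_lt_rowLen, ht.mem_shape]

theorem IsTableau.colLen_shape (ht : IsTableau t) : ht.shape.colLen 0 = t.length :=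
  eq_of_forall_lt_iff fun i => by
    rw [← YoungDiagram.mem_iff_lt_colLen, ht.mem_shape, ht.length_pos_iff]

/-- The semistandard Young tableau with the given rows. -/
def IsTableau.toSSYT (ht : IsTableau t) : SemistandardYoungTableau ht.shape where
  entry i j := (t.getD i []).getD j 0
  row_weak' := by
    intro i j₁ j₂ hj hc
    rw [ht.mem_shape] at hc
    rw [List.getD_eq_getElem _ _ hc, List.getD_eq_getElem _ _ (hj.trans hc)]
    exact List.pairwise_iff_getElem.1 (ht.pairwise_getD i) _ _ _ _ hj
  col_strict' := by
    intro i₁ i₂ j hi hc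
    rw [ht.mem_shape] at hc
    induction i₂, hi using Nat.le_induction with
    | base => exact (ht.above_getD i₁).getD_lt hc
    | succ i hi ih =>
      have h := (ht.above_getD i).length_le
      exact (ih (hc.trans_le h)).trans ((ht.above_getD i).getD_lt hc)
  zeros' := by
    intro i j hc
    rw [ht.mem_shape, not_lt] at hc
    exact List.getD_eq_default _ _ hc

theorem IsTableau.toSSYT_apply (ht : IsTableau t) (i j : ℕ) :
    ht.toSSYT i j = (t.getD i []).getD j 0 := rfl

theorem map_getD_range (l : List ℕ) : (List.range l.length).map (fun j => l.getD j 0) = l := by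
  apply List.ext_getElem
  · simp
  · intro i h₁ h₂
    simp [h₂]

theorem IsTableau.tableauRow_toSSYT (ht : IsTableau t) (i : ℕ) :
    tableauRow ht.toSSYT i = t.getD i [] := by
  rw [tableauRow, ht.rowLen_shape]
  exact map_getD_range _

theorem tableauWord_eq_flatMap (t : List (List ℕ)) :
    tableauWord t = (List.range t.length).reverse.flatMap fun i => t.getD i [] := by
  induction t with
  | nil => rfl
  | cons R t ih =>
    rw [tableauWord, ih, List.length_cons, List.range_succ_eq_map, List.reverse_cons,
      List.flatMap_append, ← List.map_reverse, List.flatMap_map]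
    simp

theorem IsTableau.rowReadingWord_toSSYT (ht : IsTableau t) :
    rowReadingWord ht.toSSYT = tableauWord t := by
  rw [rowReadingWord, ht.colLen_shape, tableauWord_eq_flatMap]
  congr 1
  exact funext ht.tableauRow_toSSYT

theorem card_filter_getD (l : List ℕ) (a : ℕ) :
    ((Finset.range l.length).filter fun j => l.getD j 0 = a).card = l.count a := by
  conv_rhs => rw [← map_getD_range l]
  rw [List.count, List.countP_map, List.countP_eq_length_filter,
    ← List.toFinset_card_of_nodup (List.nodup_range.filter _)]
  congr 1
  ext j
  simp

theorem count_tableauWord (t : List (List ℕ)) (a : ℕ) :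
    (tableauWord t).count a = ∑ i ∈ Finset.range t.length, (t.getD i []).count a := by
  induction t with
  | nil => rfl
  | cons R t ih =>
    rw [tableauWord, List.count_append, ih, List.length_cons, Finset.sum_range_succ']
    simp

theorem IsTableau.tableauContent_toSSYT (ht : IsTableau t) (a : ℕ) :
    tableauContent ht.toSSYT a = (tableauWord t).count a := by
  have h : (ht.shape.cells.filter fun c => ht.toSSYT c.1 c.2 = a) =
      (Finset.range t.length).biUnion fun i =>
        ((Finset.range (t.getD i []).length).filter fun j => (t.getD i []).getD j 0 = a).image
          fun j => (i, j) := by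
    ext ⟨i, j⟩
    rw [Finset.mem_filter, YoungDiagram.mem_cells, ht.mem_shape, ht.toSSYT_apply]
    simp only [Finset.mem_filter, Finset.mem_biUnion, Finset.mem_image, Finset.mem_range,
      Prod.mk.injEq]
    constructor
    · rintro ⟨hj, ha⟩
      exact ⟨i, (ht.length_pos_iff i).1 (by omega), j, ⟨hj, ha⟩, rfl, rfl⟩
    · rintro ⟨_, _, _, h, rfl, rfl⟩
      exact h
  rw [tableauContent, h, Finset.card_biUnion, count_tableauWord]
  · refine Finset.sum_congr rfl fun i _ => ?_
    rw [Finset.card_image_of_injective _ (Prod.mk_right_injective i), card_filter_getD]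
  · intro i _ j _ hij
    rw [Function.onFun, Finset.disjoint_left]
    simp only [Finset.mem_image]
    rintro _ ⟨_, _, rfl⟩ ⟨_, _, h⟩
    exact hij (Prod.ext_iff.1 h).1.symm

/-! ### The recording tableau -/

theorem mem_columnWord {M : Rows} {x K a : ℕ} (h : a ∈ columnWord M x K) : 1 ≤ a ∧ a ≤ K := by
  induction K with
  | zero => simp [columnWord] at h
  | succ K ih =>
    rw [columnWord, List.mem_append] at h
    rcases h with h | h
    · split_ifs at h
      · rw [List.mem_singleton] at h
        omega
      · simp at h
    · have := ih h
      omega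

theorem mem_arrWord {M : Rows} {cs : List ℕ} {K a : ℕ} (h : a ∈ arrWord cs K M) :
    1 ≤ a ∧ a ≤ K := by
  rw [arrWord, List.mem_flatMap] at h
  obtain ⟨x, -, h⟩ := h
  exact mem_columnWord h

theorem recordingRow_pairwise (n L : ℕ) (M : Rows) (j : ℕ) :
    (recordingRow n L M j).Pairwise (· ≤ ·) := by
  rw [recordingRow, List.pairwise_flatMap]
  refine ⟨fun r _ => List.pairwise_replicate.2 (Or.inr le_rfl), ?_⟩
  have h : (List.range' 1 L).Pairwise (· < ·) := List.pairwise_lt_range'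
  refine h.imp fun hrs x hx y hy => ?_
  rw [List.eq_of_mem_replicate hx, List.eq_of_mem_replicate hy]
  exact hrs.le

theorem count_recordingRow (n L : ℕ) (M : Rows) (j a : ℕ) :
    (recordingRow n L M j).count a = if 1 ≤ a ∧ a ≤ L then
      (collapse n M a j).card - (collapse n M (a - 1) j).card else 0 := by
  have h : a ∈ (List.range' 1 L).toFinset ↔ 1 ≤ a ∧ a ≤ L := by
    rw [List.mem_toFinset, List.mem_range'_1]
    omega
  rw [recordingRow, List.count_flatMap, ← List.sum_toFinset _ List.nodup_range']
  simp only [Function.comp_apply, List.count_replicate, beq_iff_eq, Finset.sum_ite_eq', h]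

theorem countP_le_sub_countP_le {a : ℕ} (ha : 1 ≤ a) (l : List ℕ) :
    l.countP (· ≤ a) - l.countP (· ≤ a - 1) = l.count a := by
  have : l.countP (· ≤ a) = l.countP (· ≤ a - 1) + l.count a := by
    induction l with
    | nil => rfl
    | cons b l ih =>
      simp only [List.countP_cons, List.count_cons, ih, decide_eq_true_eq, beq_iff_eq]
      split_ifs <;> omega
  omega

/-- The rows of the tableau that is Knuth equivalent to the column reading word are those of the
recording tableau. -/
theorem recordingRow_eq_getD {n L : ℕ} {M : Rows} (hM : ∀ k, 1 ≤ k → M k ⊆ Finset.Icc 1 n)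
    (ht : IsTableau t) (hp : Plactic (arrWord (List.range' 1 n) L M) (tableauWord t)) (j : ℕ) :
    recordingRow n L M (j + 1) = t.getD j [] := by
  have hmem : ∀ i, ∀ e ∈ t.getD i [], 1 ≤ e ∧ e ≤ L := by
    intro i e he
    refine mem_arrWord (M := M) (cs := List.range' 1 n) (hp.perm.mem_iff.2 ?_)
    have hi : i < t.length := (ht.length_pos_iff i).1 (List.length_pos_of_mem he)
    rw [tableauWord_eq_flatMap, List.mem_flatMap]
    exact ⟨i, by simpa using hi, he⟩
  have h1 : ∀ e ∈ t.headD [], 1 ≤ e := by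
    intro e he
    refine (hmem 0 e ?_).1
    cases t with
    | nil => simp at he
    | cons R t => simpa using he
  have hcard : ∀ r ≤ L, (collapse n M r (j + 1)).card = (t.getD j []).countP (· ≤ r) := by
    intro r hr
    rcases le_or_gt (j + 1) r with hj | hj
    · rw [card_collapse hM hr (by omega) hj, (hp.collapseWord r).perm.count_eq,
        collapseWord_tableauWord r ht h1, add_comm j 1, count_levelWord one_pos (by omega)]
    · rw [collapse_apply_of_gt hj, Finset.card_empty, eq_comm, List.countP_eq_zero]
      intro e he
      have := ht.le_of_mem_getD h1 j e he
      simp only [decide_eq_true_eq]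
      omega
  refine List.Perm.eq_of_pairwise' (recordingRow_pairwise n L M (j + 1)) (ht.pairwise_getD j) ?_
  rw [List.perm_iff_count]
  intro a
  rw [count_recordingRow]
  split_ifs with ha
  · rw [hcard a ha.2, hcard (a - 1) (by omega), countP_le_sub_countP_le ha.1]
  · rw [eq_comm, List.count_eq_zero]
    exact fun h => ha (hmem j a h)

end Tableau

end MLQueue

theorem mainTheorem1 (lam : YoungDiagram) (n : ℕ) (hn : lam.colLen 0 ≤ n)
    (M : MLQueue.Rows) (hM : M ∈ MLQueue.MLQ lam n) :
    ∃ (μ : YoungDiagram) (T : SemistandardYoungTableau μ),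
      MLQueue.IsRecordingTableau n (lam.rowLen 0) M T ∧
        MLQueue.maj (lam.rowLen 0) M = MLQueue.tableauCharge T := by
  open MLQueue in
  set L := lam.rowLen 0
  obtain ⟨hM0, hMr⟩ := hM
  have hsub : ∀ k, 1 ≤ k → M k ⊆ Finset.Icc 1 n := fun k hk => by
    obtain ⟨j, rfl⟩ := Nat.exists_eq_add_of_le' hk
    exact (hMr j).1
  have hcs : ∀ j, ∀ x ∈ M (j + 1), x ∈ List.range' 1 n := fun j x hx => by
    have := Finset.mem_Icc.1 ((hMr j).1 hx)
    rw [List.mem_range'_1]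
    omega
  have hcard : ∀ j, (M (j + 2)).card ≤ (M (j + 1)).card := fun j => by
    rw [(hMr j).2, (hMr (j + 1)).2]
    exact lam.colLen_anti j (j + 1) j.le_succ
  set w := arrWord (List.range' 1 n) L M with hw
  have hcount : ∀ a, w.count a = (M a).card := by
    intro a
    rcases Nat.eq_zero_or_pos a with rfl | ha
    · rw [hM0, Finset.card_empty, List.count_eq_zero]
      exact fun h => absurd (mem_arrWord h).1 (by omega)
    · obtain ⟨j, rfl⟩ := Nat.exists_eq_add_of_le' ha
      rcases le_or_gt (j + 1) L with hL | hL
      · exact count_arrWord List.nodup_range' (hcs j) ha hL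
      · have h0 : lam.colLen j = 0 := by
          by_contra h
          have h₁ := YoungDiagram.mem_iff_lt_colLen.2 (Nat.pos_of_ne_zero h)
          have h₂ := YoungDiagram.mem_iff_lt_rowLen.1 h₁
          omega
        rw [(hMr j).2, h0, List.count_eq_zero]
        exact fun h => absurd (mem_arrWord h).2 (by omega)
  obtain ⟨t, ht, hp⟩ := exists_tableau w
  refine ⟨ht.shape, ht.toSSYT, ⟨fun j => ?_, fun a => ?_⟩, ?_⟩
  · rw [ht.tableauRow_toSSYT, recordingRow_eq_getD hsub ht hp]
  · rw [ht.tableauContent_toSSYT, ← hp.perm.count_eq, hcount]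
  · rw [tableauCharge, ht.rowReadingWord_toSSYT,
      charge_eq_sum_energy (L := L) (fun a ha => mem_arrWord (hp.perm.mem_iff.2 ha))
        (fun k => by rw [← hp.perm.count_eq, ← hp.perm.count_eq, hcount, hcount]; exact hcard k),
      maj_eq_sum_rowEnergy List.pairwise_lt_range' hcs hcard]
    refine Finset.sum_congr rfl fun k hk => ?_
    rw [← hp.energy_eq, hw, energy_arrWord (Finset.mem_range.1 hk) M List.nodup_range']
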